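/- Let $k\ge 3$ be an integer, $\alpha>0$ and $\lambda<k$. There is a constant $C=C(k,\alpha,\lambda)$ such that the following holds. Let $I\subseteq\mathbb N$ be infinite and let $(G^{(n)})_{n\in I}$ be a $k$-regular expander graph sequence: $G^{(n)}$ is a simple $k$-regular graph on $n$ vertices and, writing $\lambda^{(n)}_1\ge\dots\ge\lambda^{(n)}_n$ for the eigenvalues of its adjacency matrix and $\lambda^{(n)}=\max\{\lambda^{(n)}_2,|\lambda^{(n)}_n|\}$, one has $\limsup_{n\to\infty,\,n\in I}\lambda^{(n)}=\lambda<k$. Assume that for every $n\in I$ the girth of $G^{(n)}$ is greater than $2\lceil\alpha\log_{k-1}n\rceil+1$. Let $W_1,W_2$ be two independent non-backtracking random walks on $G^{(n)}$, each started at a uniformly random vertex and never reset: the first step goes to a uniformly random neighbour of the starting vertex, and every later step goes to a uniformly random neighbour of the current vertex different from the vertex occupied one step before. Start with $n$ empty bins, one for each vertex of $G^{(n)}$, and at each time $t=0,1,\dots,n-1$ place one ball into the less loaded of the bins $W_1(t)$ and $W_2(t)$, breaking ties by an arbitrary deterministic rule that may depend on $t$ and on the trajectories of both walks up to time $t$.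 Then, with probability tending to $1$ as $n\to\infty$ in $I$, uniformly over all tie-breaking rules, the maximum load over all bins after these $n$ balls is at most $\log_2\log n+C$, where $\log$ is the natural logarithm. -/

import Mathlib

open Filter MeasureTheory ProbabilityTheory

/-- `max {λ₂, |λ_N|}`, where `λ₁ ≥ λ₂ ≥ ⋯ ≥ λ_N` are the eigenvalues, with multiplicity, of the
adjacency matrix of a graph on `N ≥ 2` vertices (`eigenvalues₀` lists them in decreasing order,
starting at index `0`). The value is `0` if there are fewer than two vertices. -/
noncomputable def secondEigenvalue {V : Type*} [Fintype V] [DecidableEq V]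
    (G : SimpleGraph V) [DecidableRel G.Adj] : ℝ :=
  if h : 1 < Fintype.card V then
    max ((G.isHermitian_adjMatrix ℝ).eigenvalues₀ ⟨1, h⟩)
      |(G.isHermitian_adjMatrix ℝ).eigenvalues₀ ⟨Fintype.card V - 1, by omega⟩|
  else 0

/-- `limsup` of `secondEigenvalue (G n)` as `n → ∞` within the index set `I`. (For `k`-regular
graphs the terms lie in `[0, k]`, so the real-valued `limsup` is the true one.) -/
noncomputable def limsupSecondEigenvalue (I : Set ℕ) (G : ∀ n : ℕ, SimpleGraph (Fin n))
    [∀ n, DecidableRel (G n).Adj] : ℝ :=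
  limsup (fun n => secondEigenvalue (G n)) (atTop ⊓ 𝓟 I)

/-- `(G n)_{n ∈ I}` is a `k`-regular expander graph sequence, `G n` having `n` vertices. -/
structure IsExpanderSequence (k : ℕ) (I : Set ℕ) (G : ∀ n : ℕ, SimpleGraph (Fin n))
    [∀ n, DecidableRel (G n).Adj] : Prop where
  infinite : I.Infinite
  regular : ∀ n ∈ I, (G n).IsRegularOfDegree k
  limsup_lt : limsupSecondEigenvalue I G < k

/-- `W 0, W 1, W 2, …` is a non-backtracking random walk on `G` that starts at a uniformly random
vertex: the first step goes to a uniform neighbour, and each later step goes to a uniform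
neighbour of the current vertex other than the vertex occupied one step before, conditionally on
the whole past. The transition rules are written in product form
`P(past and next step) = P(past) * (transition probability)`. -/
structure IsNonBacktrackingWalk {V : Type*} [Fintype V] [DecidableEq V] [MeasurableSpace V]
    (G : SimpleGraph V) [DecidableRel G.Adj] {Ω : Type*} [MeasurableSpace Ω] (P : Measure Ω)
    (W : ℕ → Ω → V) : Prop where
  measurable : ∀ t, Measurable (W t)
  start : ∀ v, P.real {ω | W 0 ω = v} = 1 / (Fintype.card V : ℝ)
  first_step : ∀ u v, P.real {ω | W 0 ω = u ∧ W 1 ω = v} =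
    P.real {ω | W 0 ω = u} * (if G.Adj u v then 1 / (G.degree u : ℝ) else 0)
  step : ∀ (t : ℕ) (x : ℕ → V), P.real {ω | ∀ s ≤ t + 2, W s ω = x s} =
    P.real {ω | ∀ s ≤ t + 1, W s ω = x s} *
      (if G.Adj (x (t + 1)) (x (t + 2)) ∧ x (t + 2) ≠ x t
        then 1 / ((G.degree (x (t + 1)) : ℝ) - 1) else 0)

/-- A deterministic rule for breaking ties: at each time `t` it looks at the trajectories of the two
walkers at times `0, …, t`, which also determine all past loads, and chooses the first walker's
bin (`true`) or the second walker's bin (`false`). -/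
abbrev TieRule (V : Type*) : Type _ := ∀ t : ℕ, (Fin (t + 1) → V) → (Fin (t + 1) → V) → Bool

/-- Given the load vector `q` before time `t`, the bin that receives the ball inserted at time `t`:
the less loaded of `w₁ t` and `w₂ t`, ties being broken by the rule `tie`. -/
def chosenBin {V : Type*} (tie : TieRule V) (w₁ w₂ : ℕ → V) (q : V → ℕ) (t : ℕ) : V :=
  if q (w₁ t) < q (w₂ t) then w₁ t
  else if q (w₂ t) < q (w₁ t) then w₂ t
  else if tie t (fun s => w₁ s) (fun s => w₂ s) then w₁ t
  else w₂ t

/-- The load vector after the balls of times `0, …, t - 1` have been inserted. -/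
def load {V : Type*} [DecidableEq V] (tie : TieRule V) (w₁ w₂ : ℕ → V) : ℕ → V → ℕ
  | 0 => fun _ => 0
  | t + 1 => fun v =>
      load tie w₁ w₂ t v + if v = chosenBin tie w₁ w₂ (load tie w₁ w₂ t) t then 1 else 0

/-- The maximum load over all bins after `t` balls. -/
def maxLoad {V : Type*} [Fintype V] [DecidableEq V] (tie : TieRule V) (w₁ w₂ : ℕ → V) (t : ℕ) : ℕ :=
  Finset.univ.sup (load tie w₁ w₂ t)

/-! The proof is a layered induction for the power of two choices, adapted to walkers that forget
their past in a time `τ` of order `log n`. Put `X = n ^ δ` with `δ = min α 1 / 4`.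

Two facts about one walker are used. By the spectral gap, `τ` steps bring every atom of its law
below `3 / n` (`exists_mixing_time`): non-backtracking walk counts satisfy a linear recurrence with
the adjacency operator, whose characteristic roots on the nonconstant eigenvectors have modulus well
below `k - 1`. By the girth, the walker returns to a given earlier position at a given time with
probability at most `(k - 1) ^ (-ρ)`, which is at most `X ^ (-4)` (`returnsAtMost_of_girth`).

Now suppose that at most `β n` bins have load at least `i`. Given the past up to `τ` steps earlier,
both bins offered at a given time have load at least `i` with probability at most `(3 β) ^ 2` plus a
small error for bins filled during the last `τ` steps (`pairExp_bothHeavy_le`). An exponential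
moment bound along residue classes modulo `τ` then gives at most `40 β ^ 2 n` bins of load `i + 1`,
with high probability. From `β = 1 / 80` at level `80`, about `log₂ log n` squarings bring `β` down
to `1 / X` (`pairExp_layers_le`).

Below that fraction concentration is replaced by first moments: every two further levels multiply
the probability that both offered bins are heavy by `11 / X` (`pairExp_bothHeavy_add_two_le`,
`pairExp_tail_le`). A bounded number `L` of such double levels makes `n (11 / X) ^ L` tend to `0`,
so they only add to the constant. All the estimates hold for each fixed tie-breaking rule with the
same bounds. -/

/-- The real-valued indicator of a proposition. -/
noncomputable def ind (p : Prop) : ℝ := by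
  classical exact if p then 1 else 0

lemma ind_of_true {p : Prop} (h : p) : ind p = 1 := by simp [ind, h]

lemma ind_of_false {p : Prop} (h : ¬ p) : ind p = 0 := by simp [ind, h]

lemma ind_eq_ite (p : Prop) [Decidable p] : ind p = if p then 1 else 0 := by
  unfold ind; congr

lemma ind_nonneg (p : Prop) : 0 ≤ ind p := by
  by_cases h : p <;> simp [ind, h]

lemma ind_le_one (p : Prop) : ind p ≤ 1 := by
  by_cases h : p <;> simp [ind, h]

lemma ind_mono {p q : Prop} (h : p → q) : ind p ≤ ind q := by
  by_cases hp : p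
  · rw [ind_of_true hp, ind_of_true (h hp)]
  · rw [ind_of_false hp]; exact ind_nonneg q

lemma ind_and (p q : Prop) : ind (p ∧ q) = ind p * ind q := by
  by_cases hp : p <;> by_cases hq : q <;> simp [ind, hp, hq]

lemma ind_or_le (p q : Prop) : ind (p ∨ q) ≤ ind p + ind q := by
  by_cases hp : p <;> by_cases hq : q <;> simp [ind, hp, hq]

lemma ind_exists_le_sum {ι : Type*} (s : Finset ι) (p : ι → Prop) :
    ind (∃ i ∈ s, p i) ≤ ∑ i ∈ s, ind (p i) := by
  by_cases h : ∃ i ∈ s, p i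
  · obtain ⟨i, hi, hp⟩ := h
    calc ind (∃ i ∈ s, p i) ≤ 1 := ind_le_one _
      _ = ind (p i) := (ind_of_true hp).symm
      _ ≤ ∑ i ∈ s, ind (p i) :=
        Finset.single_le_sum (f := fun i => ind (p i)) (fun j _ => ind_nonneg _) hi
  · rw [ind_of_false h]; exact Finset.sum_nonneg fun j _ => ind_nonneg _

/-! ### Expectations over non-backtracking walks as iterated finite averages. -/

section WalkExpectation

variable {V : Type*} [Fintype V] [DecidableEq V]

/-- The vertices that may follow the positions `x 0, …, x (t - 1)` of a non-backtracking walk. -/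
def nextSet (G : SimpleGraph V) [DecidableRel G.Adj] : ℕ → (ℕ → V) → Finset V
  | 0, _ => Finset.univ
  | 1, x => G.neighborFinset (x 0)
  | t + 2, x => (G.neighborFinset (x (t + 1))).erase (x t)

/-- The expectation of `f` when the positions `x 0, …, x (t - 1)` of a non-backtracking walk are
given and the positions at the times `t, …, t + m - 1` are random. -/
noncomputable def walkExp (G : SimpleGraph V) [DecidableRel G.Adj] :
    ℕ → ℕ → (ℕ → V) → ((ℕ → V) → ℝ) → ℝ
  | 0, _, x, f => f x
  | m + 1, t, x, f =>
      (∑ v ∈ nextSet G t x, walkExp G m (t + 1) (Function.update x t v) f) / (nextSet G t x).card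

/-- `f x` depends only on `x 0, …, x (t - 1)`. -/
def DependsBelow {β : Type*} (t : ℕ) (f : (ℕ → V) → β) : Prop :=
  ∀ x y : ℕ → V, (∀ s < t, x s = y s) → f x = f y

variable {G : SimpleGraph V} [DecidableRel G.Adj]

omit [Fintype V] [DecidableEq V] in
lemma update_agree {t s : ℕ} (x : ℕ → V) (v : V) (h : s < t) : Function.update x t v s = x s :=
  Function.update_of_ne h.ne v x

lemma walkExp_mono_of_agree {m t : ℕ} {x : ℕ → V} {f g : (ℕ → V) → ℝ}
    (h : ∀ x', (∀ s < t, x' s = x s) → f x' ≤ g x') : walkExp G m t x f ≤ walkExp G m t x g := by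
  induction m generalizing t x with
  | zero => exact h x fun _ _ => rfl
  | succ m ih =>
    refine div_le_div_of_nonneg_right (Finset.sum_le_sum fun v _ => ih fun x' hx' => h x' ?_)
      (Nat.cast_nonneg _)
    intro s hs
    rw [hx' s (by omega), update_agree x v hs]

lemma walkExp_congr_of_agree {m t : ℕ} {x : ℕ → V} {f g : (ℕ → V) → ℝ}
    (h : ∀ x', (∀ s < t, x' s = x s) → f x' = g x') : walkExp G m t x f = walkExp G m t x g :=
  le_antisymm (walkExp_mono_of_agree fun x' hx' => (h x' hx').le)
    (walkExp_mono_of_agree fun x' hx' => (h x' hx').ge)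

lemma walkExp_mono {m t : ℕ} {x : ℕ → V} {f g : (ℕ → V) → ℝ} (h : ∀ x', f x' ≤ g x') :
    walkExp G m t x f ≤ walkExp G m t x g :=
  walkExp_mono_of_agree fun x' _ => h x'

lemma walkExp_add {m t : ℕ} {x : ℕ → V} (f g : (ℕ → V) → ℝ) :
    walkExp G m t x (fun x' => f x' + g x') = walkExp G m t x f + walkExp G m t x g := by
  induction m generalizing t x with
  | zero => rfl
  | succ m ih => simp only [walkExp, ih, Finset.sum_add_distrib, add_div]

lemma walkExp_const_mul {m t : ℕ} {x : ℕ → V} (c : ℝ) (f : (ℕ → V) → ℝ) :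
    walkExp G m t x (fun x' => c * f x') = c * walkExp G m t x f := by
  induction m generalizing t x with
  | zero => rfl
  | succ m ih => simp only [walkExp, ih, ← Finset.mul_sum, mul_div_assoc]

lemma walkExp_zero {m t : ℕ} {x : ℕ → V} : walkExp G m t x (fun _ => 0) = 0 := by
  simpa using walkExp_const_mul (G := G) (m := m) (t := t) (x := x) 0 (fun _ => 0)

lemma walkExp_sum {ι : Type*} {m t : ℕ} {x : ℕ → V} (s : Finset ι) (f : ι → (ℕ → V) → ℝ) :
    walkExp G m t x (fun x' => ∑ i ∈ s, f i x') = ∑ i ∈ s, walkExp G m t x (f i) := by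
  classical
  induction s using Finset.induction_on with
  | empty => simp [walkExp_zero]
  | insert a s ha ih => simp [Finset.sum_insert ha, walkExp_add, ih]

lemma walkExp_nonneg {m t : ℕ} {x : ℕ → V} {f : (ℕ → V) → ℝ} (h : ∀ x', 0 ≤ f x') :
    0 ≤ walkExp G m t x f := by
  rw [← walkExp_zero (G := G) (m := m) (t := t) (x := x)]
  exact walkExp_mono h

lemma walkExp_const (hG : ∀ t x, (nextSet G t x).Nonempty) {m t : ℕ} {x : ℕ → V} (c : ℝ) :
    walkExp G m t x (fun _ => c) = c := by
  induction m generalizing t x with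
  | zero => rfl
  | succ m ih =>
    have : ((nextSet G t x).card : ℝ) ≠ 0 := by exact_mod_cast (hG t x).card_ne_zero
    simp only [walkExp, ih, Finset.sum_const, nsmul_eq_mul]
    field_simp

lemma walkExp_tower {a b t : ℕ} {x : ℕ → V} (f : (ℕ → V) → ℝ) :
    walkExp G (a + b) t x f = walkExp G a t x (fun x' => walkExp G b (t + a) x' f) := by
  induction a generalizing t x with
  | zero => simp [walkExp]
  | succ a ih =>
    rw [show a + 1 + b = (a + b) + 1 by ring]
    simp only [walkExp, ih]
    rw [show t + 1 + a = t + (a + 1) by ring]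

lemma walkExp_of_dependsBelow (hG : ∀ t x, (nextSet G t x).Nonempty) {m t : ℕ} {x : ℕ → V}
    {f : (ℕ → V) → ℝ} (hf : DependsBelow t f) : walkExp G m t x f = f x := by
  rw [walkExp_congr_of_agree (g := fun _ => f x) fun x' hx' => hf x' x hx', walkExp_const hG]

lemma walkExp_truncate (hG : ∀ t x, (nextSet G t x).Nonempty) {m a t : ℕ} {x : ℕ → V}
    {f : (ℕ → V) → ℝ} (ha : a ≤ m) (hf : DependsBelow (t + a) f) :
    walkExp G m t x f = walkExp G a t x f := by
  obtain ⟨b, rfl⟩ := Nat.exists_eq_add_of_le ha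
  rw [walkExp_tower]
  exact walkExp_congr_of_agree fun x' _ => walkExp_of_dependsBelow hG hf

lemma walkExp_comm {m t m' t' : ℕ} {x y : ℕ → V} (f : (ℕ → V) → (ℕ → V) → ℝ) :
    walkExp G m t x (fun x' => walkExp G m' t' y (fun y' => f x' y')) =
      walkExp G m' t' y (fun y' => walkExp G m t x (fun x' => f x' y')) := by
  induction m generalizing t x with
  | zero => rfl
  | succ m ih =>
    simp only [walkExp, ih, div_eq_inv_mul]
    rw [walkExp_const_mul, walkExp_sum]

lemma walkExp_le_of_forall_le (hG : ∀ t x, (nextSet G t x).Nonempty) {m t a : ℕ} {x : ℕ → V}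
    {f : (ℕ → V) → ℝ} {c : ℝ} (ha : a ≤ m)
    (h : ∀ x', (∀ s < t, x' s = x s) → walkExp G (m - a) (t + a) x' f ≤ c) :
    walkExp G m t x f ≤ c := by
  obtain ⟨b, rfl⟩ := Nat.exists_eq_add_of_le ha
  rw [walkExp_tower, ← walkExp_const hG (m := a) (t := t) (x := x) c]
  refine walkExp_mono_of_agree fun x' hx' => ?_
  simpa using h x' hx'

/-- The joint expectation over two independent non-backtracking walks. -/
noncomputable def pairExp (G : SimpleGraph V) [DecidableRel G.Adj] (m t : ℕ) (x y : ℕ → V)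
    (f : (ℕ → V) → (ℕ → V) → ℝ) : ℝ :=
  walkExp G m t x fun x' => walkExp G m t y fun y' => f x' y'

/-- `f x y` depends only on the first `t` entries of `x` and of `y`. -/
def PairDependsBelow {β : Type*} (t : ℕ) (f : (ℕ → V) → (ℕ → V) → β) : Prop :=
  ∀ x x' y y' : ℕ → V, (∀ s < t, x s = x' s) → (∀ s < t, y s = y' s) → f x y = f x' y'

omit [Fintype V] [DecidableEq V] in
lemma PairDependsBelow.mono {β : Type*} {s t : ℕ} {f : (ℕ → V) → (ℕ → V) → β}
    (h : PairDependsBelow s f) (hst : s ≤ t) : PairDependsBelow t f :=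
  fun x x' y y' hx hy => h x x' y y' (fun u hu => hx u (by omega)) fun u hu => hy u (by omega)

omit [Fintype V] [DecidableEq V] in
lemma PairDependsBelow.comp {β γ : Type*} {t : ℕ} {f : (ℕ → V) → (ℕ → V) → β}
    (h : PairDependsBelow t f) (F : β → γ) : PairDependsBelow t fun x y => F (f x y) :=
  fun x x' y y' hx hy => congrArg F (h x x' y y' hx hy)

omit [Fintype V] [DecidableEq V] in
lemma PairDependsBelow.comp₂ {β γ κ : Type*} {t : ℕ} {f : (ℕ → V) → (ℕ → V) → β}
    {g : (ℕ → V) → (ℕ → V) → γ} (hf : PairDependsBelow t f) (hg : PairDependsBelow t g)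
    (F : β → γ → κ) : PairDependsBelow t fun x y => F (f x y) (g x y) :=
  fun x x' y y' hx hy => congrArg₂ F (hf x x' y y' hx hy) (hg x x' y y' hx hy)

lemma pairExp_mono_of_agree {m t : ℕ} {x y : ℕ → V} {f g : (ℕ → V) → (ℕ → V) → ℝ}
    (h : ∀ x' y', (∀ s < t, x' s = x s) → (∀ s < t, y' s = y s) → f x' y' ≤ g x' y') :
    pairExp G m t x y f ≤ pairExp G m t x y g :=
  walkExp_mono_of_agree fun x' hx' => walkExp_mono_of_agree fun y' hy' => h x' y' hx' hy'

lemma pairExp_mono {m t : ℕ} {x y : ℕ → V} {f g : (ℕ → V) → (ℕ → V) → ℝ}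
    (h : ∀ x' y', f x' y' ≤ g x' y') : pairExp G m t x y f ≤ pairExp G m t x y g :=
  pairExp_mono_of_agree fun x' y' _ _ => h x' y'

lemma pairExp_congr {m t : ℕ} {x y : ℕ → V} {f g : (ℕ → V) → (ℕ → V) → ℝ}
    (h : ∀ x' y', f x' y' = g x' y') : pairExp G m t x y f = pairExp G m t x y g := by
  congr; ext x' y'; exact h x' y'

lemma pairExp_add {m t : ℕ} {x y : ℕ → V} (f g : (ℕ → V) → (ℕ → V) → ℝ) :
    pairExp G m t x y (fun x' y' => f x' y' + g x' y') =
      pairExp G m t x y f + pairExp G m t x y g := by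
  simp only [pairExp, walkExp_add]

lemma pairExp_const_mul {m t : ℕ} {x y : ℕ → V} (c : ℝ) (f : (ℕ → V) → (ℕ → V) → ℝ) :
    pairExp G m t x y (fun x' y' => c * f x' y') = c * pairExp G m t x y f := by
  simp only [pairExp, walkExp_const_mul]

lemma pairExp_sum {ι : Type*} {m t : ℕ} {x y : ℕ → V} (s : Finset ι)
    (f : ι → (ℕ → V) → (ℕ → V) → ℝ) :
    pairExp G m t x y (fun x' y' => ∑ i ∈ s, f i x' y') = ∑ i ∈ s, pairExp G m t x y (f i) := by
  simp only [pairExp, walkExp_sum]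

lemma pairExp_const (hG : ∀ t x, (nextSet G t x).Nonempty) {m t : ℕ} {x y : ℕ → V} (c : ℝ) :
    pairExp G m t x y (fun _ _ => c) = c := by
  simp only [pairExp, walkExp_const hG]

lemma pairExp_comm {m t : ℕ} {x y : ℕ → V} (f : (ℕ → V) → (ℕ → V) → ℝ) :
    pairExp G m t x y f = pairExp G m t y x (fun y' x' => f x' y') :=
  walkExp_comm f

lemma pairExp_tower {a b t : ℕ} {x y : ℕ → V} (f : (ℕ → V) → (ℕ → V) → ℝ) :
    pairExp G (a + b) t x y f =
      pairExp G a t x y (fun x' y' => pairExp G b (t + a) x' y' f) := by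
  simp only [pairExp, walkExp_tower]
  refine walkExp_congr_of_agree fun x' _ => ?_
  -- The later block of the first walk is exchanged with the earlier block of the second.
  rw [walkExp_comm]

lemma pairExp_of_dependsBelow (hG : ∀ t x, (nextSet G t x).Nonempty) {m t : ℕ} {x y : ℕ → V}
    {f : (ℕ → V) → (ℕ → V) → ℝ} (hf : PairDependsBelow t f) : pairExp G m t x y f = f x y := by
  rw [← pairExp_const hG (m := m) (t := t) (x := x) (y := y) (f x y)]
  exact le_antisymm (pairExp_mono_of_agree fun x' y' hx hy => (hf x' x y' y hx hy).le)
    (pairExp_mono_of_agree fun x' y' hx hy => (hf x' x y' y hx hy).ge)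

/-- Bounding a factor by its conditional expectation given the past. -/
lemma pairExp_mul_le (hG : ∀ t x, (nextSet G t x).Nonempty) {s H : ℕ} (hs : s ≤ H) {x y : ℕ → V}
    {A B C : (ℕ → V) → (ℕ → V) → ℝ} (hA : PairDependsBelow s A) (hA0 : ∀ x y, 0 ≤ A x y)
    (hC : PairDependsBelow s C) (h : ∀ x y, pairExp G (H - s) s x y B ≤ C x y) :
    pairExp G H 0 x y (fun x y => A x y * B x y) ≤
      pairExp G H 0 x y (fun x y => A x y * C x y) := by
  obtain ⟨b, rfl⟩ := Nat.exists_eq_add_of_le hs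
  simp only [pairExp_tower, zero_add]
  refine pairExp_mono fun x' y' => ?_
  rw [pairExp_of_dependsBelow hG (hA.comp₂ hC (· * ·))]
  calc pairExp G b s x' y' (fun x y => A x y * B x y)
      ≤ pairExp G b s x' y' (fun x y => A x' y' * B x y) :=
        pairExp_mono_of_agree fun x'' y'' hx hy => by rw [hA x'' x' y'' y' hx hy]
    _ = A x' y' * pairExp G b s x' y' B := pairExp_const_mul _ _
    _ ≤ A x' y' * C x' y' := by
        refine mul_le_mul_of_nonneg_left ?_ (hA0 x' y')
        simpa using h x' y'

end WalkExpectation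

/-! ### Deterministic facts about loads, valid for every pair of trajectories. -/

section Loads

variable {V : Type*} [Fintype V] [DecidableEq V] (tie : TieRule V)

/-- The bins of load at least `i` before time `t`. -/
def heavyBins (x y : ℕ → V) (i t : ℕ) : Finset V :=
  Finset.univ.filter fun v => i ≤ load tie x y t v

/-- Both bins offered at time `t` have load at least `i`. -/
def BothHeavy (x y : ℕ → V) (i t : ℕ) : Prop :=
  i ≤ load tie x y t (x t) ∧ i ≤ load tie x y t (y t)

variable {tie} {x y : ℕ → V}

omit [Fintype V] in
lemma load_succ (t : ℕ) (v : V) : load tie x y (t + 1) v =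
    load tie x y t v + if v = chosenBin tie x y (load tie x y t) t then 1 else 0 := rfl

omit [Fintype V] [DecidableEq V] in
lemma chosenBin_eq_or (q : V → ℕ) (t : ℕ) :
    (chosenBin tie x y q t = x t ∨ chosenBin tie x y q t = y t) ∧
      q (chosenBin tie x y q t) ≤ q (x t) ∧ q (chosenBin tie x y q t) ≤ q (y t) := by
  unfold chosenBin
  split_ifs <;> simp <;> omega

omit [Fintype V] in
lemma load_congr {x' y' : ℕ → V} {t : ℕ} (hx : ∀ s < t, x s = x' s) (hy : ∀ s < t, y s = y' s) :
    load tie x y t = load tie x' y' t := by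
  induction t with
  | zero => rfl
  | succ t ih =>
    have h := ih (fun s hs => hx s (by omega)) (fun s hs => hy s (by omega))
    have hx' : (fun s : Fin (t + 1) => x s) = fun s : Fin (t + 1) => x' s :=
      funext fun s => hx s s.2
    have hy' : (fun s : Fin (t + 1) => y s) = fun s : Fin (t + 1) => y' s :=
      funext fun s => hy s s.2
    have hc : chosenBin tie x y (load tie x' y' t) t = chosenBin tie x' y' (load tie x' y' t) t := by
      simp only [chosenBin, hx', hy', hx t (by omega), hy t (by omega)]
    ext v
    rw [load_succ, load_succ, h, hc]

omit [Fintype V] in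
lemma load_mono (v : V) : Monotone fun t => load tie x y t v :=
  monotone_nat_of_le_succ fun t => by rw [load_succ]; omega

lemma sum_load (t : ℕ) : ∑ v, load tie x y t v = t := by
  induction t with
  | zero => simp [load]
  | succ t ih => simp [load_succ, Finset.sum_add_distrib, ih]

lemma mem_heavyBins {i t : ℕ} {v : V} : v ∈ heavyBins tie x y i t ↔ i ≤ load tie x y t v := by
  simp [heavyBins]

lemma card_heavyBins_mul_le (i t : ℕ) : (heavyBins tie x y i t).card * i ≤ t := by
  calc (heavyBins tie x y i t).card * i
      = ∑ _v ∈ heavyBins tie x y i t, i := by simp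
    _ ≤ ∑ v ∈ heavyBins tie x y i t, load tie x y t v :=
        Finset.sum_le_sum fun v hv => mem_heavyBins.1 hv
    _ ≤ ∑ v, load tie x y t v :=
        Finset.sum_le_sum_of_subset (Finset.subset_univ _)
    _ = t := sum_load t

lemma heavyBins_mono {i j s t : ℕ} (hij : i ≤ j) (hst : s ≤ t) :
    heavyBins tie x y j s ⊆ heavyBins tie x y i t := fun v hv => by
  rw [mem_heavyBins] at *
  exact hij.trans (hv.trans (load_mono v hst))

omit [Fintype V] in
lemma BothHeavy.mono {i j t : ℕ} (h : BothHeavy tie x y j t) (hij : i ≤ j) :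
    BothHeavy tie x y i t := ⟨hij.trans h.1, hij.trans h.2⟩

lemma heavyBins_pairDependsBelow (i t : ℕ) :
    PairDependsBelow t fun x y : ℕ → V => heavyBins tie x y i t :=
  fun x x' y y' hx hy => by simp only [heavyBins, load_congr hx hy]

lemma heavyBins_congr {x' y' : ℕ → V} {i t : ℕ} (hx : ∀ s < t, x s = x' s)
    (hy : ∀ s < t, y s = y' s) : heavyBins tie x y i t = heavyBins tie x' y' i t :=
  heavyBins_pairDependsBelow i t x x' y y' hx hy

omit [Fintype V] in
lemma bothHeavy_pairDependsBelow (i t : ℕ) :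
    PairDependsBelow (t + 1) fun x y : ℕ → V => BothHeavy tie x y i t :=
  fun x x' y y' hx hy => by
    have h : load tie x y t = load tie x' y' t :=
      load_congr (fun s hs => hx s (by omega)) fun s hs => hy s (by omega)
    simp only [BothHeavy, h, hx t (by omega), hy t (by omega)]

omit [Fintype V] in
/-- If the load of `v` exceeds `i` between the times `s` and `t`, then some ball raises it from
`i` to `i + 1`. -/
lemma exists_ball_of_load_lt {i s t : ℕ} {v : V} (hst : s ≤ t) (hs : load tie x y s v ≤ i)
    (ht : i < load tie x y t v) :
    ∃ u, s ≤ u ∧ u < t ∧ BothHeavy tie x y i u ∧ (x u = v ∨ y u = v) ∧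
      load tie x y (u + 1) v = i + 1 := by
  induction t, hst using Nat.le_induction with
  | base => omega
  | succ t hst ih =>
    by_cases h : i < load tie x y t v
    · obtain ⟨u, h1, h2, h3⟩ := ih h
      exact ⟨u, h1, by omega, h3⟩
    · have hl := load_succ (tie := tie) (x := x) (y := y) t v
      split_ifs at hl with hv
      · have hi : load tie x y t v = i := by omega
        obtain ⟨hc, h1, h2⟩ := chosenBin_eq_or (tie := tie) (x := x) (y := y) (load tie x y t) t
        rw [← hv] at hc h1 h2
        refine ⟨t, hst, by omega, ⟨by omega, by omega⟩, ?_, by omega⟩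
        exact hc.imp Eq.symm Eq.symm
      · omega

/-- The bins of load at least `i + 1` are counted by the balls placed when both bins offered had
load at least `i`. -/
lemma card_heavyBins_succ_le (i t : ℕ) : ((heavyBins tie x y (i + 1) t).card : ℝ) ≤
    ∑ s ∈ Finset.range t, ind (BothHeavy tie x y i s) := by
  induction t with
  | zero => simp [heavyBins, load]
  | succ t ih =>
    rw [Finset.sum_range_succ]
    by_cases h : BothHeavy tie x y i t
    · rw [ind_of_true h]
      have hsub : heavyBins tie x y (i + 1) (t + 1) ⊆
          insert (chosenBin tie x y (load tie x y t) t) (heavyBins tie x y (i + 1) t) := by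
        intro v hv
        rw [mem_heavyBins, load_succ] at hv
        rw [Finset.mem_insert, mem_heavyBins]
        split_ifs at hv with hc
        · exact Or.inl hc
        · exact Or.inr hv
      have := (Finset.card_le_card hsub).trans (Finset.card_insert_le _ _)
      have h2 : ((heavyBins tie x y (i + 1) (t + 1)).card : ℝ) ≤
        (heavyBins tie x y (i + 1) t).card + 1 := by exact_mod_cast this
      linarith
    · rw [ind_of_false h, add_zero]
      refine le_trans ?_ ih
      have hsub : heavyBins tie x y (i + 1) (t + 1) ⊆ heavyBins tie x y (i + 1) t := by
        intro v hv
        rw [mem_heavyBins] at *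
        by_contra hlt
        refine h ?_
        obtain ⟨hc, h1, h2⟩ := chosenBin_eq_or (tie := tie) (x := x) (y := y) (load tie x y t) t
        rw [load_succ] at hv
        split_ifs at hv with hvc
        · rw [← hvc] at h1 h2
          exact ⟨by omega, by omega⟩
        · omega
      exact_mod_cast Finset.card_le_card hsub

lemma exists_bothHeavy_of_lt_maxLoad {i t : ℕ} (h : i < maxLoad tie x y t) :
    ∃ s ∈ Finset.range t, BothHeavy tie x y i s := by
  obtain ⟨v, -, hv⟩ := (Finset.lt_sup_iff).1 h
  obtain ⟨u, -, h2, h3, -⟩ := exists_ball_of_load_lt (s := 0) (Nat.zero_le t) (Nat.zero_le i) hv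
  exact ⟨u, Finset.mem_range.2 h2, h3⟩

/-- A bin heavy at time `t` was heavy already at time `s`, or received a ball in between and so was
visited by one of the walkers. With `s` about `τ` steps before `t`, the first case is governed by
mixing and the second is a rare coincidence. -/
lemma bothHeavy_cases {i s t : ℕ} (hst : s ≤ t) (h : BothHeavy tie x y i t) :
    (x t ∈ heavyBins tie x y i s ∧ y t ∈ heavyBins tie x y i s) ∨
      ∃ u ∈ Finset.Ico s t, (x t = x u ∨ y t = y u) ∨ (x t = y u ∨ y t = x u) := by
  have key : ∀ v, i ≤ load tie x y t v → v ∈ heavyBins tie x y i s ∨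
      ∃ u ∈ Finset.Ico s t, x u = v ∨ y u = v := by
    intro v hv
    by_cases hs : i ≤ load tie x y s v
    · exact Or.inl (mem_heavyBins.2 hs)
    · obtain ⟨u, h1, h2, -, h4, -⟩ := exists_ball_of_load_lt (tie := tie)
        (x := x) (y := y) (i := i - 1) (v := v) hst (by omega)
        (by omega)
      exact Or.inr ⟨u, Finset.mem_Ico.2 ⟨h1, h2⟩, h4⟩
  rcases key _ h.1 with hx | ⟨u, hu, hx⟩
  · rcases key _ h.2 with hy | ⟨u, hu, hy⟩
    · exact Or.inl ⟨hx, hy⟩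
    · exact Or.inr ⟨u, hu, by rcases hy with hy | hy <;> simp [hy]⟩
  · exact Or.inr ⟨u, hu, by rcases hx with hx | hx <;> simp [hx]⟩

/-- Climbing two levels after time `s` takes two balls; with the visit at time `t` itself this makes
three visits to one bin by two walkers, so by pigeonhole some walker visits it twice. Going up by
two levels thus avoids encounters between different walkers, which conditioning on the time of the
first visit would not make unlikely. -/
lemma bothHeavy_cases_of_two_visits {i s t : ℕ} (hst : s ≤ t)
    (h : BothHeavy tie x y (i + 2) t) :
    (x t ∈ heavyBins tie x y (i + 1) s ∧ y t ∈ heavyBins tie x y (i + 1) s) ∨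
      ∃ u ∈ Finset.Ico s t, ∃ u' ∈ Finset.Ioc u t, BothHeavy tie x y i u ∧
        (x u' = x u ∨ y u' = y u) := by
  have key : ∀ v, i + 2 ≤ load tie x y t v → (v = x t ∨ v = y t) →
      v ∈ heavyBins tie x y (i + 1) s ∨ ∃ u ∈ Finset.Ico s t, ∃ u' ∈ Finset.Ioc u t,
        BothHeavy tie x y i u ∧ (x u' = x u ∨ y u' = y u) := by
    intro v hv hvt
    by_cases hs : i + 1 ≤ load tie x y s v
    · exact Or.inl (mem_heavyBins.2 hs)
    · right
      obtain ⟨a, ha1, ha2, ha3, ha4, ha5⟩ := exists_ball_of_load_lt (tie := tie)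
        (x := x) (y := y) (i := i) (v := v) hst
        (by omega) (by omega)
      obtain ⟨b, hb1, hb2, hb3, hb4, -⟩ := exists_ball_of_load_lt (tie := tie)
        (x := x) (y := y) (i := i + 1) (s := a + 1)
        (t := t) (v := v) (by omega) (by omega) (by omega)
      have hb3' := hb3.mono (Nat.le_succ i)
      -- The repeated visitor occurs at the times `a, t`, or `b, t`, or else `a, b`.
      by_cases h1 : (x t = x a ∨ y t = y a)
      · exact ⟨a, Finset.mem_Ico.2 ⟨ha1, ha2⟩, t, Finset.mem_Ioc.2 ⟨ha2, le_rfl⟩, ha3, h1⟩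
      by_cases h2 : (x t = x b ∨ y t = y b)
      · exact ⟨b, Finset.mem_Ico.2 ⟨by omega, hb2⟩, t, Finset.mem_Ioc.2 ⟨hb2, le_rfl⟩, hb3', h2⟩
      refine ⟨a, Finset.mem_Ico.2 ⟨ha1, ha2⟩, b, Finset.mem_Ioc.2 ⟨by omega, hb2.le⟩, ha3, ?_⟩
      push Not at h1 h2
      rcases hvt with rfl | rfl <;> rcases ha4 with ha4 | ha4 <;> rcases hb4 with hb4 | hb4 <;>
        simp_all
  rcases key _ h.1 (Or.inl rfl) with hx | hx
  · rcases key _ h.2 (Or.inr rfl) with hy | hy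
    · exact Or.inl ⟨hx, hy⟩
    · exact Or.inr hy
  · exact Or.inr hx

end Loads

/-! ### Probabilistic steps of the layered induction, from mixing and rarity of returns. -/

section Phases

variable {V : Type*} [Fintype V] [DecidableEq V] {G : SimpleGraph V} [DecidableRel G.Adj]

/-- Within `τ` steps the law of a walker has all its atoms bounded by `μ`, whatever its past. -/
def MixesWithin (G : SimpleGraph V) [DecidableRel G.Adj] (τ : ℕ) (μ : ℝ) : Prop :=
  ∀ (t : ℕ) (x : ℕ → V) (v : V),
    walkExp G (t + 1 - (t + 1 - τ)) (t + 1 - τ) x (fun x' => ind (x' t = v)) ≤ μ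

/-- The probability that a walker visits its current position again at a given later time is at
most `η`. -/
def ReturnsAtMost (G : SimpleGraph V) [DecidableRel G.Adj] (η : ℝ) : Prop :=
  ∀ (s t : ℕ) (x : ℕ → V), s < t →
    walkExp G (t - s) (s + 1) x (fun x' => ind (x' t = x s)) ≤ η

variable (hG : ∀ t (x : ℕ → V), (nextSet G t x).Nonempty) {τ H : ℕ} {μ η : ℝ}
  (hM : MixesWithin G τ μ) (hR : ReturnsAtMost G η)

include hG hM in
lemma walkExp_position_le {t : ℕ} (ht : t < H) (x : ℕ → V) (v : V) :
    walkExp G (H - (t + 1 - τ)) (t + 1 - τ) x (fun x' => ind (x' t = v)) ≤ μ := by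
  rw [walkExp_truncate hG (a := t + 1 - (t + 1 - τ)) (by omega)]
  · exact hM t x v
  · intro x y h
    exact congrArg (fun a => ind (a = _)) (h t (by omega))

include hG hM in
lemma walkExp_mem_le {t : ℕ} (ht : t < H) (x : ℕ → V) (S : Finset V) :
    walkExp G (H - (t + 1 - τ)) (t + 1 - τ) x (fun x' => ind (x' t ∈ S)) ≤ S.card * μ := by
  calc walkExp G (H - (t + 1 - τ)) (t + 1 - τ) x (fun x' => ind (x' t ∈ S))
      ≤ walkExp G (H - (t + 1 - τ)) (t + 1 - τ) x (fun x' => ∑ v ∈ S, ind (x' t = v)) :=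
        walkExp_mono fun x' => (ind_mono fun h => ⟨x' t, h, rfl⟩).trans (ind_exists_le_sum S _)
    _ = ∑ v ∈ S, walkExp G (H - (t + 1 - τ)) (t + 1 - τ) x (fun x' => ind (x' t = v)) :=
        walkExp_sum _ _
    _ ≤ S.card * μ := by
        rw [← nsmul_eq_mul]
        exact Finset.sum_le_card_nsmul _ _ _ fun v _ => walkExp_position_le hG hM ht x v

-- Conditioning further, up to time `u`, fixes `x' u`, and the return bound applies whatever
-- happened before.
include hG hR in
lemma walkExp_return_le {s u t : ℕ} (hsu : s ≤ u + 1) (hut : u < t) (ht : t < H) (x : ℕ → V) :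
    walkExp G (H - s) s x (fun x' => ind (x' t = x' u)) ≤ η := by
  refine walkExp_le_of_forall_le hG (a := u + 1 - s) (by omega) fun x' _ => ?_
  rw [show H - s - (u + 1 - s) = H - (u + 1) by omega, show s + (u + 1 - s) = u + 1 by omega]
  rw [walkExp_congr_of_agree (g := fun x'' => ind (x'' t = x' u))
    fun x'' h => by rw [h u (by omega)]]
  rw [walkExp_truncate hG (a := t - u) (by omega)]
  · exact hR u t x' hut
  · intro x y h
    exact congrArg (fun a => ind (a = _)) (h t (by omega))

lemma pairExp_mul_separate {m t : ℕ} {x y : ℕ → V} (f g : (ℕ → V) → ℝ) :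
    pairExp G m t x y (fun x' y' => f x' * g y') = walkExp G m t x f * walkExp G m t y g := by
  simp only [pairExp, walkExp_const_mul]
  simp only [mul_comm _ (walkExp G m t y g), walkExp_const_mul]

include hG in
lemma pairExp_left {m t : ℕ} {x y : ℕ → V} (f : (ℕ → V) → ℝ) :
    pairExp G m t x y (fun x' _ => f x') = walkExp G m t x f := by
  simp only [pairExp, walkExp_const hG]

include hG in
lemma pairExp_right {m t : ℕ} {x y : ℕ → V} (f : (ℕ → V) → ℝ) :
    pairExp G m t x y (fun _ y' => f y') = walkExp G m t y f := by
  simp only [pairExp, walkExp_const hG]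

-- Even when `u` lies inside the mixing window, independence allows the whole second trajectory to
-- be fixed first; the target `y' u` is then a constant vertex.
include hG hM in
lemma pairExp_meet_le {t u : ℕ} (ht : t < H) (x y : ℕ → V) :
    pairExp G (H - (t + 1 - τ)) (t + 1 - τ) x y (fun x' y' => ind (x' t = y' u)) ≤ μ := by
  rw [pairExp_comm]
  exact walkExp_le_of_forall_le hG (a := H - (t + 1 - τ)) le_rfl fun y' _ => by
    simpa [walkExp] using walkExp_position_le hG hM ht x (y' u)

include hG hM in
lemma pairExp_both_mem_le (hμ : 0 ≤ μ) {t : ℕ} (ht : t < H) (x y : ℕ → V) (S : Finset V) :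
    pairExp G (H - (t + 1 - τ)) (t + 1 - τ) x y (fun x' y' => ind (x' t ∈ S ∧ y' t ∈ S)) ≤
      (S.card * μ) ^ 2 := by
  simp only [ind_and]
  rw [pairExp_mul_separate (fun x' => ind (x' t ∈ S)) (fun y' => ind (y' t ∈ S)), sq]
  exact mul_le_mul (walkExp_mem_le hG hM ht x S) (walkExp_mem_le hG hM ht y S)
    (walkExp_nonneg fun _ => ind_nonneg _) (by positivity)

variable (tie : TieRule V)

-- The heavy set is frozen `τ` steps before time `t`, when the walkers are still independent of
-- where they will mix to: both hit it with probability at most the square. Each of the fewer than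
-- `τ` intermediate times contributes two returns and two encounters. For `t < τ` the truncated
-- subtraction makes the window start at time `0`.
include hG hM hR in
lemma pairExp_bothHeavy_le (hμ : 0 ≤ μ) (hη : 0 ≤ η) (hτ : 1 ≤ τ) {t : ℕ} (ht : t < H) (i : ℕ)
    (x y : ℕ → V) :
    pairExp G (H - (t + 1 - τ)) (t + 1 - τ) x y (fun x' y' => ind (BothHeavy tie x' y' i t)) ≤
      ((heavyBins tie x y i (t + 1 - τ)).card * μ) ^ 2 + τ * (2 * η + 2 * μ) := by
  set s := t + 1 - τ with hs
  set S := heavyBins tie x y i s with hS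
  have hterm : ∀ u ∈ Finset.Ico s t, pairExp G (H - s) s x y (fun x' y' =>
      ind (x' t = x' u) + ind (y' t = y' u) + (ind (x' t = y' u) + ind (y' t = x' u))) ≤
        2 * η + 2 * μ := by
    intro u hu
    obtain ⟨h1, h2⟩ := Finset.mem_Ico.1 hu
    rw [pairExp_add, pairExp_add, pairExp_add]
    rw [pairExp_left hG (fun x' => ind (x' t = x' u)), pairExp_right hG (fun y' => ind (y' t = y' u))]
    have e1 := walkExp_return_le hG hR (by omega) h2 ht x (s := s)
    have e2 := walkExp_return_le hG hR (by omega) h2 ht y (s := s)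
    have e3 := pairExp_meet_le hG hM ht x y (u := u)
    have e4 : pairExp G (H - s) s x y (fun x' y' => ind (y' t = x' u)) ≤ μ := by
      rw [pairExp_comm]
      exact pairExp_meet_le hG hM ht y x (u := u)
    linarith
  calc pairExp G (H - s) s x y (fun x' y' => ind (BothHeavy tie x' y' i t))
      ≤ pairExp G (H - s) s x y (fun x' y' => ind (x' t ∈ S ∧ y' t ∈ S) +
          ∑ u ∈ Finset.Ico s t, (ind (x' t = x' u) + ind (y' t = y' u) +
            (ind (x' t = y' u) + ind (y' t = x' u)))) := by
        refine pairExp_mono_of_agree fun x' y' hx hy => ?_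
        have hSeq : heavyBins tie x' y' i s = S := heavyBins_pairDependsBelow i s x' x y' y hx hy
        refine (ind_mono (bothHeavy_cases (s := s) (by omega))).trans ((ind_or_le _ _).trans ?_)
        rw [hSeq]
        refine add_le_add le_rfl ((ind_exists_le_sum _ _).trans (Finset.sum_le_sum fun u _ => ?_))
        exact (ind_or_le _ _).trans (add_le_add (ind_or_le _ _) (ind_or_le _ _))
    _ = pairExp G (H - s) s x y (fun x' y' => ind (x' t ∈ S ∧ y' t ∈ S)) +
          ∑ u ∈ Finset.Ico s t, pairExp G (H - s) s x y (fun x' y' =>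
            (ind (x' t = x' u) + ind (y' t = y' u) + (ind (x' t = y' u) + ind (y' t = x' u)))) := by
        rw [pairExp_add, pairExp_sum]
    _ ≤ (S.card * μ) ^ 2 + (Finset.Ico s t).card • (2 * η + 2 * μ) :=
        add_le_add (pairExp_both_mem_le hG hM hμ ht x y S) (Finset.sum_le_card_nsmul _ _ _ hterm)
    _ ≤ (S.card * μ) ^ 2 + τ * (2 * η + 2 * μ) := by
        rw [nsmul_eq_mul, Nat.card_Ico]
        gcongr
        omega

include hG in
/-- An exponential moment bound for events that are conditionally unlikely given the past up to
`τ` steps before them. -/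
lemma pairExp_prod_le {M : ℕ} (hτ : 1 ≤ τ) {A : ℕ → (ℕ → V) → (ℕ → V) → Prop} {p : ℝ} (hp : 0 ≤ p)
    (hA : ∀ t, PairDependsBelow (t + 1) (A t))
    (hAp : ∀ t < M * τ, ∀ x y, pairExp G (M * τ - (t + 1 - τ)) (t + 1 - τ) x y
      (fun x' y' => ind (A t x' y')) ≤ p) (x y : ℕ → V) {r : ℕ} (hr : r < τ) :
    ∀ m ≤ M, pairExp G (M * τ) 0 x y
      (fun x' y' => ∏ j ∈ Finset.range m, (1 + ind (A (r + j * τ) x' y'))) ≤ (1 + p) ^ m := by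
  intro m
  induction m with
  | zero => intro _; simp [pairExp_const hG]
  | succ m ih =>
    intro hm
    have hm' : m * τ + τ ≤ M * τ := by
      calc m * τ + τ = (m + 1) * τ := by ring
        _ ≤ M * τ := Nat.mul_le_mul_right τ hm
    simp only [Finset.prod_range_succ]
    -- Within one residue class consecutive times are `τ` apart, so all earlier factors are known at
    -- the moment from which the next event is conditionally unlikely.
    have hdep : PairDependsBelow (r + m * τ + 1 - τ)
        (fun x' y' : ℕ → V => ∏ j ∈ Finset.range m, (1 + ind (A (r + j * τ) x' y'))) := by
      intro x x' y y' hx hy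
      refine Finset.prod_congr rfl fun j hj => ?_
      have hj' : j * τ + τ ≤ m * τ := by
        calc j * τ + τ = (j + 1) * τ := by ring
          _ ≤ m * τ := Nat.mul_le_mul_right τ (Finset.mem_range.1 hj)
      rw [hA (r + j * τ) x x' y y' (fun s hs => hx s (by omega)) fun s hs => hy s (by omega)]
    refine (pairExp_mul_le hG (s := r + m * τ + 1 - τ) (by omega) hdep
      (fun x' y' => Finset.prod_nonneg fun j _ => by linarith [ind_nonneg (A (r + j * τ) x' y')])
      (C := fun _ _ => 1 + p) (fun _ _ _ _ _ _ => rfl) fun x' y' => ?_).trans ?_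
    · rw [pairExp_add, pairExp_const hG]
      linarith [hAp (r + m * τ) (by omega) x' y']
    · simp only [mul_comm _ (1 + p)]
      rw [pairExp_const_mul, pow_succ, mul_comm _ (1 + p)]
      exact mul_le_mul_of_nonneg_left (ih (by omega)) (by linarith)

lemma sum_range_mul_eq (M τ : ℕ) (f : ℕ → ℝ) :
    ∑ t ∈ Finset.range (M * τ), f t =
      ∑ r ∈ Finset.range τ, ∑ j ∈ Finset.range M, f (r + j * τ) := by
  rw [Finset.sum_comm]
  induction M with
  | zero => simp
  | succ M ih =>
    rw [add_mul, one_mul, Finset.sum_range_add, ih, Finset.sum_range_succ]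
    simp only [add_comm (M * τ)]

-- If the total reaches `a * τ`, one of the `τ` residue classes contributes at least `a`. Since `1 +
-- ind` is `2 ^ ind`, the product over a class is an exponential moment in base `2`, and Markov's
-- inequality with a union bound concludes.
include hG in
lemma pairExp_le_sum_ind_le {M : ℕ} (hτ : 1 ≤ τ) {A : ℕ → (ℕ → V) → (ℕ → V) → Prop} {p : ℝ}
    (hp : 0 ≤ p) (hA : ∀ t, PairDependsBelow (t + 1) (A t))
    (hAp : ∀ t < M * τ, ∀ x y, pairExp G (M * τ - (t + 1 - τ)) (t + 1 - τ) x y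
      (fun x' y' => ind (A t x' y')) ≤ p) (x y : ℕ → V) (a : ℝ) :
    pairExp G (M * τ) 0 x y
      (fun x' y' => ind (a * τ ≤ ∑ t ∈ Finset.range (M * τ), ind (A t x' y'))) ≤
      τ * ((1 + p) ^ M * (2 : ℝ) ^ (-a)) := by
  have hpt : ∀ x' y' : ℕ → V,
      ind (a * τ ≤ ∑ t ∈ Finset.range (M * τ), ind (A t x' y')) ≤
        ∑ r ∈ Finset.range τ, (2 : ℝ) ^ (-a) *
          ∏ j ∈ Finset.range M, (1 + ind (A (r + j * τ) x' y')) := by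
    intro x' y'
    have hex : a * τ ≤ ∑ t ∈ Finset.range (M * τ), ind (A t x' y') →
        ∃ r ∈ Finset.range τ, a ≤ ∑ j ∈ Finset.range M, ind (A (r + j * τ) x' y') := by
      intro h
      by_contra! hcon
      rw [sum_range_mul_eq] at h
      have := Finset.sum_lt_sum_of_nonempty (Finset.nonempty_range_iff.2 (by omega)) hcon
      rw [Finset.sum_const, Finset.card_range, nsmul_eq_mul] at this
      linarith
    refine (ind_mono hex).trans ((ind_exists_le_sum _ _).trans (Finset.sum_le_sum fun r _ => ?_))
    have hprod : ∏ j ∈ Finset.range M, (1 + ind (A (r + j * τ) x' y')) =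
        (2 : ℝ) ^ (∑ j ∈ Finset.range M, ind (A (r + j * τ) x' y')) := by
      rw [Real.rpow_sum_of_pos (by norm_num)]
      refine Finset.prod_congr rfl fun j _ => ?_
      by_cases h : A (r + j * τ) x' y'
      · rw [ind_of_true h]; norm_num
      · rw [ind_of_false h]; norm_num
    rw [hprod, ← Real.rpow_add (by norm_num)]
    by_cases h : a ≤ ∑ j ∈ Finset.range M, ind (A (r + j * τ) x' y')
    · rw [ind_of_true h]
      exact Real.one_le_rpow (by norm_num) (by linarith)
    · rw [ind_of_false h]; positivity
  calc _ ≤ _ := pairExp_mono hpt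
    _ = ∑ r ∈ Finset.range τ, (2 : ℝ) ^ (-a) * pairExp G (M * τ) 0 x y (fun x' y' =>
          ∏ j ∈ Finset.range M, (1 + ind (A (r + j * τ) x' y'))) := by
        rw [pairExp_sum]
        exact Finset.sum_congr rfl fun r _ => pairExp_const_mul _ _
    _ ≤ (Finset.range τ).card • ((2 : ℝ) ^ (-a) * (1 + p) ^ M) := by
        refine Finset.sum_le_card_nsmul _ _ _ fun r hr => ?_
        refine mul_le_mul_of_nonneg_left ?_ (by positivity)
        exact pairExp_prod_le hG hτ hp hA hAp x y (Finset.mem_range.1 hr) M le_rfl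
    _ = τ * ((1 + p) ^ M * (2 : ℝ) ^ (-a)) := by
        rw [Finset.card_range, nsmul_eq_mul]; ring

include hG hM hR in
/-- One level of the layered induction. -/
lemma pairExp_heavyBins_succ_le (hμ : 0 ≤ μ) (hη : 0 ≤ η) (hτ : 1 ≤ τ) {M n : ℕ}
    (hn : n ≤ M * τ) (i : ℕ) {b a p : ℝ} (hp : (b * μ) ^ 2 + τ * (2 * η + 2 * μ) ≤ p)
    (x y : ℕ → V) :
    pairExp G (M * τ) 0 x y (fun x' y' => ind (((heavyBins tie x' y' i n).card : ℝ) ≤ b ∧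
      a * τ < (heavyBins tie x' y' (i + 1) n).card)) ≤ τ * ((1 + p) ^ M * (2 : ℝ) ^ (-a)) := by
  have hp0 : 0 ≤ p := le_trans (by positivity) hp
  -- Smallness of the heavy set, as seen at the conditioning time, is built into the event. Its
  -- conditional probability is then at most `p` for every past, including those with too many heavy
  -- bins.
  set A : ℕ → (ℕ → V) → (ℕ → V) → Prop := fun t x' y' =>
    BothHeavy tie x' y' i t ∧ ((heavyBins tie x' y' i (t + 1 - τ)).card : ℝ) ≤ b with hAdef
  refine le_trans (pairExp_mono fun x' y' => ind_mono ?_)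
    (pairExp_le_sum_ind_le hG hτ (A := A) hp0 ?_ ?_ x y a)
  · rintro ⟨h1, h2⟩
    refine h2.le.trans ((card_heavyBins_succ_le i n).trans ?_)
    calc ∑ t ∈ Finset.range n, ind (BothHeavy tie x' y' i t)
        ≤ ∑ t ∈ Finset.range n, ind (A t x' y') := by
          refine Finset.sum_le_sum fun t ht => ind_mono fun h => ⟨h, le_trans ?_ h1⟩
          have := Finset.mem_range.1 ht
          exact_mod_cast Finset.card_le_card (heavyBins_mono le_rfl (by omega))
      _ ≤ ∑ t ∈ Finset.range (M * τ), ind (A t x' y') :=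
          Finset.sum_le_sum_of_subset_of_nonneg (Finset.range_mono hn) fun _ _ _ => ind_nonneg _
  · intro t
    exact (bothHeavy_pairDependsBelow i t).comp₂
      (((heavyBins_pairDependsBelow i (t + 1 - τ)).mono (by omega)).comp
        fun S => (S.card : ℝ) ≤ b) And
  · intro t ht x' y'
    by_cases hb : ((heavyBins tie x' y' i (t + 1 - τ)).card : ℝ) ≤ b
    · refine le_trans (pairExp_mono fun x'' y'' => ind_mono And.left)
        ((pairExp_bothHeavy_le hG hM hR tie hμ hη hτ ht i x' y').trans (le_trans ?_ hp))
      gcongr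
    · refine le_trans (pairExp_mono_of_agree (g := fun _ _ => 0) fun x'' y'' hx hy => ?_) ?_
      · refine (ind_of_false fun h => hb ?_).le
        have := h.2
        rwa [heavyBins_congr hx hy] at this
      · rw [pairExp_const hG]; exact hp0

include hG hM hR in
/-- Once few bins have load `i₁`, two further levels multiply the probability that a ball meets
two heavy bins by a small factor. -/
lemma pairExp_bothHeavy_add_two_le (hμ : 0 ≤ μ) (hη : 0 ≤ η) (hτ : 1 ≤ τ) {n : ℕ} (hn : n ≤ H)
    {i i₁ : ℕ} (hi : i₁ ≤ i + 1) {b d : ℝ} (hb : 0 ≤ b) (hd : 0 ≤ d) (x y : ℕ → V)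
    (h : ∀ t < n, pairExp G H 0 x y (fun x' y' => ind (BothHeavy tie x' y' i t ∧
      ((heavyBins tie x' y' i₁ t).card : ℝ) ≤ b)) ≤ d) :
    ∀ t < n, pairExp G H 0 x y (fun x' y' => ind (BothHeavy tie x' y' (i + 2) t ∧
      ((heavyBins tie x' y' i₁ t).card : ℝ) ≤ b)) ≤ (μ ^ 2 * b * n + 2 * τ ^ 2 * η) * d := by
  intro t ht
  set s := t + 1 - τ with hs
  set g : ℕ → (ℕ → V) → (ℕ → V) → Prop := fun u x' y' =>
    ((heavyBins tie x' y' i₁ u).card : ℝ) ≤ b with hg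
  have hgmono : ∀ {u u' : ℕ} {x' y' : ℕ → V}, u ≤ u' → g u' x' y' → g u x' y' := by
    intro u u' x' y' huu h
    refine le_trans ?_ h
    exact_mod_cast Finset.card_le_card (heavyBins_mono le_rfl huu)
  have hgdep : ∀ u, PairDependsBelow u (g u) := fun u =>
    (heavyBins_pairDependsBelow i₁ u).comp fun S => (S.card : ℝ) ≤ b
  -- Either both offered bins were already heavy before the mixing window, or some walker returned
  -- inside it to a position where both offered bins had load at least `i`. Each alternative keeps a
  -- level-`i` event, which supplies the factor `d`.
  have hpt : ∀ x' y' : ℕ → V, ind (BothHeavy tie x' y' (i + 2) t ∧ g t x' y') ≤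
      ind (g s x' y') * ind (x' t ∈ heavyBins tie x' y' (i + 1) s ∧
        y' t ∈ heavyBins tie x' y' (i + 1) s) +
      ∑ u ∈ Finset.Ico s t, ∑ u' ∈ Finset.Ioc u t,
        ind (BothHeavy tie x' y' i u ∧ g u x' y') * (ind (x' u' = x' u) + ind (y' u' = y' u)) := by
    intro x' y'
    have h1 : BothHeavy tie x' y' (i + 2) t ∧ g t x' y' →
        (g s x' y' ∧ (x' t ∈ heavyBins tie x' y' (i + 1) s ∧
          y' t ∈ heavyBins tie x' y' (i + 1) s)) ∨
        ∃ u ∈ Finset.Ico s t, ∃ u' ∈ Finset.Ioc u t, (BothHeavy tie x' y' i u ∧ g u x' y') ∧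
          (x' u' = x' u ∨ y' u' = y' u) := by
      rintro ⟨hB, hgt⟩
      rcases bothHeavy_cases_of_two_visits (s := s) (by omega) hB with h | ⟨u, hu, u', hu', h2, h3⟩
      · exact Or.inl ⟨hgmono (by omega) hgt, h⟩
      · exact Or.inr ⟨u, hu, u', hu', ⟨h2, hgmono (Finset.mem_Ico.1 hu).2.le hgt⟩, h3⟩
    refine (ind_mono h1).trans ((ind_or_le _ _).trans (add_le_add (ind_and _ _).le ?_))
    refine (ind_exists_le_sum _ _).trans (Finset.sum_le_sum fun u _ => ?_)
    refine (ind_exists_le_sum _ _).trans (Finset.sum_le_sum fun u' _ => ?_)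
    rw [ind_and]
    exact mul_le_mul_of_nonneg_left (ind_or_le _ _) (ind_nonneg _)
  have hfirst : pairExp G H 0 x y (fun x' y' => ind (g s x' y') *
      ind (x' t ∈ heavyBins tie x' y' (i + 1) s ∧ y' t ∈ heavyBins tie x' y' (i + 1) s)) ≤
      μ ^ 2 * b * n * d := by
    refine (pairExp_mul_le hG (s := s) (by omega) ((hgdep s).comp ind) (fun _ _ => ind_nonneg _)
      (C := fun x' y' => ((heavyBins tie x' y' (i + 1) s).card * μ) ^ 2)
      ((heavyBins_pairDependsBelow (i + 1) s).comp fun S => ((S.card : ℝ) * μ) ^ 2)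
      fun x' y' => ?_).trans ?_
    · refine le_trans (pairExp_mono_of_agree fun x'' y'' hx hy => ?_)
        (pairExp_both_mem_le hG hM hμ (by omega : t < H) x' y' (heavyBins tie x' y' (i + 1) s))
      rw [heavyBins_congr hx hy]
    · calc pairExp G H 0 x y (fun x' y' => ind (g s x' y') *
            ((heavyBins tie x' y' (i + 1) s).card * μ) ^ 2)
          ≤ pairExp G H 0 x y (fun x' y' => μ ^ 2 * b * ∑ u ∈ Finset.range s,
              ind (BothHeavy tie x' y' i u ∧ g u x' y')) := by
            refine pairExp_mono fun x' y' => ?_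
            by_cases hgs : g s x' y'
            · rw [ind_of_true hgs, one_mul]
              have h1 : ((heavyBins tie x' y' (i + 1) s).card : ℝ) ≤ b := by
                refine le_trans ?_ hgs
                exact_mod_cast Finset.card_le_card (heavyBins_mono hi le_rfl)
              have h2 : ((heavyBins tie x' y' (i + 1) s).card : ℝ) ≤
                  ∑ u ∈ Finset.range s, ind (BothHeavy tie x' y' i u ∧ g u x' y') :=
                (card_heavyBins_succ_le i s).trans (Finset.sum_le_sum fun u hu =>
                  ind_mono fun h => ⟨h, hgmono (Finset.mem_range.1 hu).le hgs⟩)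
              -- One factor of the squared cardinality is bounded by `b`, the other by the number of
              -- level-`i` events, whose expectation is at most `n * d`.
              calc ((heavyBins tie x' y' (i + 1) s).card * μ) ^ 2
                  = μ ^ 2 * ((heavyBins tie x' y' (i + 1) s).card *
                      (heavyBins tie x' y' (i + 1) s).card) := by ring
                _ ≤ μ ^ 2 * (b * ∑ u ∈ Finset.range s,
                      ind (BothHeavy tie x' y' i u ∧ g u x' y')) := by gcongr
                _ = _ := by ring
            · rw [ind_of_false hgs, zero_mul]
              exact mul_nonneg (by positivity) (Finset.sum_nonneg fun _ _ => ind_nonneg _)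
        _ = μ ^ 2 * b * ∑ u ∈ Finset.range s, pairExp G H 0 x y (fun x' y' =>
              ind (BothHeavy tie x' y' i u ∧ g u x' y')) := by
            rw [pairExp_const_mul, pairExp_sum]
        _ ≤ μ ^ 2 * b * (n * d) := by
            refine mul_le_mul_of_nonneg_left ?_ (by positivity)
            calc _ ≤ (Finset.range s).card • d := Finset.sum_le_card_nsmul _ _ _ fun u hu =>
                  h u (by have := Finset.mem_range.1 hu; omega)
              _ ≤ n * d := by
                  rw [nsmul_eq_mul, Finset.card_range]
                  gcongr
                  omega
        _ = μ ^ 2 * b * n * d := by ring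
  have hsecond : ∀ u ∈ Finset.Ico s t, ∀ u' ∈ Finset.Ioc u t, pairExp G H 0 x y (fun x' y' =>
      ind (BothHeavy tie x' y' i u ∧ g u x' y') * (ind (x' u' = x' u) + ind (y' u' = y' u))) ≤
      2 * η * d := by
    intro u hu u' hu'
    obtain ⟨hu1, hu2⟩ := Finset.mem_Ico.1 hu
    obtain ⟨hu3, hu4⟩ := Finset.mem_Ioc.1 hu'
    refine (pairExp_mul_le hG (s := u + 1) (by omega)
      (((bothHeavy_pairDependsBelow i u).comp₂ ((hgdep u).mono (Nat.le_succ u)) And).comp ind)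
      (fun _ _ => ind_nonneg _) (C := fun _ _ => 2 * η) (fun _ _ _ _ _ _ => rfl)
      fun x' y' => ?_).trans ?_
    · rw [pairExp_add, pairExp_left hG (fun x' => ind (x' u' = x' u)),
        pairExp_right hG (fun y' => ind (y' u' = y' u))]
      have e1 := walkExp_return_le hG hR le_rfl hu3 (by omega : u' < H) x'
      have e2 := walkExp_return_le hG hR le_rfl hu3 (by omega : u' < H) y'
      linarith
    · simp only [mul_comm _ (2 * η)]
      rw [pairExp_const_mul]
      exact mul_le_mul_of_nonneg_left (h u (by omega)) (by positivity)
  calc _ ≤ _ := pairExp_mono hpt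
    _ = pairExp G H 0 x y (fun x' y' => ind (g s x' y') *
          ind (x' t ∈ heavyBins tie x' y' (i + 1) s ∧ y' t ∈ heavyBins tie x' y' (i + 1) s)) +
        ∑ u ∈ Finset.Ico s t, ∑ u' ∈ Finset.Ioc u t, pairExp G H 0 x y (fun x' y' =>
          ind (BothHeavy tie x' y' i u ∧ g u x' y') *
            (ind (x' u' = x' u) + ind (y' u' = y' u))) := by
        rw [pairExp_add, pairExp_sum]
        simp only [pairExp_sum]
    _ ≤ μ ^ 2 * b * n * d + (Finset.Ico s t).card • (τ * (2 * η * d)) := by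
        refine add_le_add hfirst (Finset.sum_le_card_nsmul _ _ _ fun u hu => ?_)
        refine (Finset.sum_le_card_nsmul _ _ _ (hsecond u hu)).trans ?_
        rw [nsmul_eq_mul, Nat.card_Ioc]
        have := Finset.mem_Ico.1 hu
        gcongr
        omega
    _ ≤ μ ^ 2 * b * n * d + τ * (τ * (2 * η * d)) := by
        rw [nsmul_eq_mul, Nat.card_Ico]
        gcongr
        omega
    _ = (μ ^ 2 * b * n + 2 * τ ^ 2 * η) * d := by ring

end Phases

/-! ### Comparison of the iterated averages with the laws of the actual walks. -/

section Law

variable {V : Type*} [Fintype V] [DecidableEq V] {G : SimpleGraph V} [DecidableRel G.Adj]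

lemma nextSet_congr {t : ℕ} {x y : ℕ → V} (h : ∀ s < t, x s = y s) :
    nextSet G t x = nextSet G t y := by
  match t with
  | 0 => rfl
  | 1 => exact congrArg (fun v => G.neighborFinset v) (h 0 (by omega))
  | t + 2 =>
    exact congrArg₂ (fun u v => (G.neighborFinset u).erase v) (h (t + 1) (by omega))
      (h t (by omega))

lemma nextSet_nonempty {k : ℕ} (hk : 3 ≤ k) (hreg : G.IsRegularOfDegree k) [Nonempty V] (t : ℕ)
    (x : ℕ → V) : (nextSet G t x).Nonempty := by
  match t with
  | 0 => exact Finset.univ_nonempty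
  | 1 =>
    rw [← Finset.card_pos, nextSet, G.card_neighborFinset_eq_degree, hreg (x 0)]; omega
  | t + 2 =>
    rw [← Finset.card_pos, nextSet]
    have := Finset.pred_card_le_card_erase (s := G.neighborFinset (x (t + 1))) (a := x t)
    rw [G.card_neighborFinset_eq_degree, hreg (x (t + 1))] at this
    omega

/-- The probability that a non-backtracking walk starts with `x 0, …, x (t - 1)`. -/
noncomputable def pathWeight (G : SimpleGraph V) [DecidableRel G.Adj] (t : ℕ) (x : ℕ → V) : ℝ :=
  ∏ s ∈ Finset.range t, if x s ∈ nextSet G s x then ((nextSet G s x).card : ℝ)⁻¹ else 0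

lemma pathWeight_congr {t : ℕ} {x y : ℕ → V} (h : ∀ s < t, x s = y s) :
    pathWeight G t x = pathWeight G t y := by
  refine Finset.prod_congr rfl fun s hs => ?_
  have hs' := Finset.mem_range.1 hs
  rw [nextSet_congr (G := G) (t := s) fun u hu => h u (by omega), h s hs']

/-- The trajectory that follows `p` up to time `H` and `x₀` afterwards. -/
def extendPath {H : ℕ} (p : Fin H → V) (x₀ : ℕ → V) (s : ℕ) : V :=
  if h : s < H then p ⟨s, h⟩ else x₀ s

omit [Fintype V] [DecidableEq V] in
lemma extendPath_of_lt {H : ℕ} (p : Fin H → V) (x₀ : ℕ → V) {s : ℕ} (h : s < H) :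
    extendPath p x₀ s = p ⟨s, h⟩ := dif_pos h

omit [Fintype V] [DecidableEq V] in
lemma extendPath_snoc {H : ℕ} (p : Fin H → V) (v : V) (x₀ : ℕ → V) :
    extendPath (Fin.snoc p v : Fin (H + 1) → V) x₀ =
      Function.update (extendPath p x₀) H v := by
  ext s
  rcases lt_trichotomy s H with h | rfl | h
  · rw [update_agree _ _ h, extendPath_of_lt _ _ h, extendPath_of_lt _ _ (by omega : s < H + 1)]
    simp [Fin.snoc, h]
  · rw [Function.update_self, extendPath_of_lt _ _ (by omega : s < s + 1)]
    simp [Fin.snoc]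
  · rw [Function.update_of_ne (by omega)]
    simp [extendPath, show ¬ s < H + 1 by omega, show ¬ s < H by omega]

lemma walkExp_eq_sum (H : ℕ) (x₀ : ℕ → V) (f : (ℕ → V) → ℝ) :
    walkExp G H 0 x₀ f =
      ∑ p : Fin H → V, pathWeight G H (extendPath p x₀) * f (extendPath p x₀) := by
  induction H generalizing f with
  | zero =>
    have : extendPath (default : Fin 0 → V) x₀ = x₀ := by ext s; simp [extendPath]
    simp [walkExp, pathWeight, this]
  | succ H ih =>
    rw [walkExp_tower, ih, ← (Fin.snocEquiv fun _ => V).sum_comp, Fintype.sum_prod_type_right]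
    refine Finset.sum_congr rfl fun p _ => ?_
    simp only [zero_add, walkExp]
    set e := extendPath p x₀ with he
    have hw : ∀ v, pathWeight G (H + 1) (Function.update e H v) =
        pathWeight G H e * if v ∈ nextSet G H e then ((nextSet G H e).card : ℝ)⁻¹ else 0 := by
      intro v
      have hag : ∀ s < H, Function.update e H v s = e s := fun s hs => update_agree e v hs
      rw [pathWeight, Finset.prod_range_succ, ← pathWeight, pathWeight_congr hag,
        nextSet_congr hag, Function.update_self]
    have hs : ∀ v, (Fin.snocEquiv fun _ => V) (v, p) = (Fin.snoc p v : Fin (H + 1) → V) :=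
      fun v => rfl
    simp only [hs, extendPath_snoc, ← he, hw]
    rw [div_eq_mul_inv, Finset.sum_mul, Finset.mul_sum, ← Finset.sum_filter_add_sum_filter_not
      Finset.univ (fun v => v ∈ nextSet G H e)]
    rw [Finset.sum_eq_zero (s := Finset.univ.filter fun v => v ∉ nextSet G H e), add_zero]
    · rw [Finset.filter_mem_eq_inter, Finset.univ_inter]
      refine Finset.sum_congr rfl fun v hv => ?_
      rw [if_pos hv]; ring
    · intro v hv
      rw [if_neg (Finset.mem_filter.1 hv).2]; ring

variable [MeasurableSpace V] {Ω : Type*} [MeasurableSpace Ω]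
  {P : Measure Ω} [IsProbabilityMeasure P]

lemma IsNonBacktrackingWalk.path_prob {k : ℕ} (hk : 3 ≤ k) (hreg : G.IsRegularOfDegree k)
    {W : ℕ → Ω → V} (hW : IsNonBacktrackingWalk G P W) (t : ℕ) (x : ℕ → V) :
    P.real {ω | ∀ s < t, W s ω = x s} = pathWeight G t x := by
  induction t with
  | zero => simp [pathWeight]
  | succ t ih =>
    rw [pathWeight, Finset.prod_range_succ, ← pathWeight, ← ih]
    match t with
    | 0 =>
      have := hW.start (x 0)
      simp [nextSet, this]
    | 1 =>
      have h1 : {ω | ∀ s < 1 + 1, W s ω = x s} = {ω | W 0 ω = x 0 ∧ W 1 ω = x 1} := by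
        ext ω
        refine ⟨fun h => ⟨h 0 (by omega), h 1 (by omega)⟩, fun h s hs => ?_⟩
        interval_cases s
        exacts [h.1, h.2]
      have h2 : {ω | ∀ s < 1, W s ω = x s} = {ω | W 0 ω = x 0} := by
        ext ω; simp
      rw [h1, h2, hW.first_step]
      simp [nextSet]
    | t + 2 =>
      have h1 : {ω | ∀ s < t + 2 + 1, W s ω = x s} = {ω | ∀ s ≤ t + 2, W s ω = x s} := by
        simp only [Nat.lt_succ_iff]
      have h2 : {ω | ∀ s < t + 2, W s ω = x s} = {ω | ∀ s ≤ t + 1, W s ω = x s} := by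
        simp only [show ∀ s, s < t + 2 ↔ s ≤ t + 1 from fun s => by omega]
      rw [h1, hW.step, ← h2]
      -- Erasing the previous vertex leaves `k - 1` choices only if it is a neighbour of the current
      -- one; otherwise the prefix has probability zero and both sides vanish.
      by_cases hadj : G.Adj (x t) (x (t + 1))
      · congr 1
        have hcard : ((nextSet G (t + 2) x).card : ℝ) = (G.degree (x (t + 1)) : ℝ) - 1 := by
          rw [nextSet, Finset.card_erase_of_mem (by simpa using hadj.symm),
            G.card_neighborFinset_eq_degree, hreg, Nat.cast_sub (by omega), Nat.cast_one]
        rw [hcard, one_div]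
        simp only [nextSet, Finset.mem_erase, SimpleGraph.mem_neighborFinset, and_comm]
      · have hzero : P.real {ω | ∀ s < t + 2, W s ω = x s} = 0 := by
          rw [ih, pathWeight, Finset.prod_range_succ]
          match t with
          | 0 => simp [nextSet, hadj]
          | t + 1 => simp [nextSet, hadj]
        rw [hzero, zero_mul, zero_mul]

/-- Probabilities of events that depend on the two walks up to time `H`. -/
lemma prob_eq_pairExp [MeasurableSingletonClass V] {k : ℕ} (hk : 3 ≤ k) (hreg : G.IsRegularOfDegree k) {W₁ W₂ : ℕ → Ω → V}
    (h₁ : IsNonBacktrackingWalk G P W₁) (h₂ : IsNonBacktrackingWalk G P W₂)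
    (hind : IndepFun (fun ω t => W₁ t ω) (fun ω t => W₂ t ω) P) {H : ℕ}
    {A : (ℕ → V) → (ℕ → V) → Prop} (hA : PairDependsBelow H A) (x₀ y₀ : ℕ → V) :
    P.real {ω | A (fun t => W₁ t ω) fun t => W₂ t ω} =
      pairExp G H 0 x₀ y₀ fun x y => ind (A x y) := by
  classical
  have hmeas : ∀ x : ℕ → V, MeasurableSet {w : ℕ → V | ∀ s < H, w s = x s} := by
    intro x
    have : {w : ℕ → V | ∀ s < H, w s = x s} = ⋂ s, ⋂ (_ : s < H), (fun w => w s) ⁻¹' {x s} := by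
      ext w; simp
    rw [this]
    exact MeasurableSet.iInter fun s => MeasurableSet.iInter fun _ =>
      measurable_pi_apply s (measurableSet_singleton _)
  have hjoint : ∀ x y : ℕ → V, P.real ({ω | ∀ s < H, W₁ s ω = x s} ∩ {ω | ∀ s < H, W₂ s ω = y s}) =
      pathWeight G H x * pathWeight G H y := by
    intro x y
    rw [← h₁.path_prob hk hreg H x, ← h₂.path_prob hk hreg H y]
    have := hind.measure_inter_preimage_eq_mul _ _ (hmeas x) (hmeas y)
    simp only [Measure.real]
    rw [← ENNReal.toReal_mul]
    exact congrArg ENNReal.toReal this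
  set f : Ω → (Fin H → V) × (Fin H → V) := fun ω => (fun s => W₁ s ω, fun s => W₂ s ω) with hf
  have hfib : ∀ p q : Fin H → V, f ⁻¹' {(p, q)} =
      {ω | ∀ s < H, W₁ s ω = extendPath p x₀ s} ∩ {ω | ∀ s < H, W₂ s ω = extendPath q y₀ s} := by
    intro p q
    ext ω
    simp only [hf, Set.mem_preimage, Set.mem_singleton_iff, Prod.mk.injEq, Set.mem_inter_iff,
      Set.mem_ofPred_eq, funext_iff]
    refine and_congr ⟨fun h s hs => ?_, fun h s => ?_⟩ ⟨fun h s hs => ?_, fun h s => ?_⟩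
    · rw [extendPath_of_lt _ _ hs]; exact h ⟨s, hs⟩
    · rw [h s s.2, extendPath_of_lt _ _ s.2]
    · rw [extendPath_of_lt _ _ hs]; exact h ⟨s, hs⟩
    · rw [h s s.2, extendPath_of_lt _ _ s.2]
  set S : Finset ((Fin H → V) × (Fin H → V)) :=
    Finset.univ.filter fun pq => A (extendPath pq.1 x₀) (extendPath pq.2 y₀) with hS
  have hpre : {ω | A (fun t => W₁ t ω) fun t => W₂ t ω} = f ⁻¹' S := by
    ext ω
    simp only [hS, hf, Set.mem_ofPred_eq, Set.mem_preimage, Finset.mem_coe, Finset.mem_filter,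
      Finset.mem_univ, true_and]
    refine iff_of_eq (hA _ _ _ _ (fun s hs => ?_) fun s hs => ?_)
    · rw [extendPath_of_lt _ _ hs]
    · rw [extendPath_of_lt _ _ hs]
  have hmW : ∀ {W : ℕ → Ω → V}, IsNonBacktrackingWalk G P W → ∀ x : ℕ → V,
      MeasurableSet {ω | ∀ s < H, W s ω = x s} := by
    intro W hW x
    exact (measurable_pi_lambda (fun ω t => W t ω) hW.measurable) (hmeas x)
  rw [hpre, ← sum_measureReal_preimage_singleton S]
  · simp only [pairExp, walkExp_eq_sum, Finset.mul_sum]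
    rw [← Fintype.sum_prod_type', hS, Finset.sum_filter]
    refine Finset.sum_congr rfl fun pq _ => ?_
    rw [ind_eq_ite]
    split_ifs with h
    · rw [show pq = (pq.1, pq.2) from rfl, hfib, hjoint]; ring
    · ring
  · rintro ⟨p, q⟩ -
    rw [hfib]
    exact (hmW h₁ _).inter (hmW h₂ _)

end Law

/-! ### Non-backtracking walks: girth, counting recurrences and return probabilities. -/

section NonBacktracking

variable {V : Type*} {G : SimpleGraph V}

/-- `z 0, …, z m` is a non-backtracking sequence of vertices. -/
def IsNonBacktrackingSeq (G : SimpleGraph V) (m : ℕ) (z : ℕ → V) : Prop :=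
  (∀ i < m, G.Adj (z i) (z (i + 1))) ∧ ∀ i, i + 2 ≤ m → z (i + 2) ≠ z i

lemma IsNonBacktrackingSeq.shift {m : ℕ} {z : ℕ → V} (h : IsNonBacktrackingSeq G m z) {i l : ℕ}
    (hil : i + l ≤ m) : IsNonBacktrackingSeq G l fun s => z (i + s) :=
  ⟨fun s hs => h.1 (i + s) (by omega), fun s hs => h.2 (i + s) (by omega)⟩

lemma exists_walk_of_adj {m : ℕ} {z : ℕ → V} (h : ∀ i < m, G.Adj (z i) (z (i + 1))) :
    ∃ p : G.Walk (z 0) (z m), p.support = (List.range (m + 1)).map z := by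
  induction m generalizing z with
  | zero => exact ⟨SimpleGraph.Walk.nil, by simp⟩
  | succ m ih =>
    obtain ⟨p, hp⟩ := ih (z := fun i => z (i + 1)) fun i hi => h (i + 1) (by omega)
    refine ⟨SimpleGraph.Walk.cons (h 0 (by omega)) p, ?_⟩
    rw [SimpleGraph.Walk.support_cons, hp, List.range_succ_eq_map (n := m + 1)]
    simp [List.map_map, Function.comp_def]

/-- A shortest closed piece is a cycle: a repetition among `z 1, …, z m` gives a shorter closed
piece, and without one the sequence is itself a cycle. No condition is imposed where the sequence
closes up, so backtracking at the base point is harmless. -/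
lemma IsNonBacktrackingSeq.egirth_le {m : ℕ} {z : ℕ → V} (h : IsNonBacktrackingSeq G m z)
    (hm : 1 ≤ m) (hz : z 0 = z m) : G.egirth ≤ m := by
  induction m using Nat.strong_induction_on generalizing z with
  | _ m ih =>
    by_cases hinj : ∀ i j, 1 ≤ i → i < j → j ≤ m → z i ≠ z j
    · have hm3 : 3 ≤ m := by
        by_contra hlt
        have h1 := h.1 0 (by omega)
        obtain rfl | rfl : m = 1 ∨ m = 2 := by omega
        · exact h1.ne hz
        · exact h.2 0 le_rfl hz.symm
      obtain ⟨p, hp⟩ := exists_walk_of_adj h.1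
      have hlen : p.length = m := by
        have := p.length_support
        rw [hp] at this
        simpa using this.symm
      have hcyc : (p.copy rfl hz.symm).IsCycle := by
        rw [SimpleGraph.Walk.isCycle_iff_isPath_tail_and_le_length]
        refine ⟨?_, by simpa [hlen] using hm3⟩
        rw [SimpleGraph.Walk.isPath_def, SimpleGraph.Walk.support_tail_of_not_nil, SimpleGraph.Walk.support_copy, hp,
          List.range_succ_eq_map, List.map_cons, List.tail_cons, List.map_map]
        · refine (List.nodup_map_iff_inj_on List.nodup_range).2 fun i hi j hj hij => ?_
          simp only [List.mem_range, Function.comp_apply] at hi hj hij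
          by_contra hne
          rcases lt_or_gt_of_ne hne with hlt | hlt
          · exact hinj (i + 1) (j + 1) (by omega) (by omega) (by omega) hij
          · exact hinj (j + 1) (i + 1) (by omega) (by omega) (by omega) hij.symm
        · rw [← SimpleGraph.Walk.length_eq_zero_iff.not.trans (Iff.rfl)]
          simp [hlen]; omega
      simpa [hlen] using SimpleGraph.egirth_le_length hcyc
    · push Not at hinj
      obtain ⟨i, j, hi, hij, hj, hzij⟩ := hinj
      have := ih (j - i) (by omega) (h.shift (i := i) (l := j - i) (by omega)) (by omega)
        (by simpa [show i + (j - i) = j by omega] using hzij)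
      refine this.trans ?_
      exact_mod_cast (by omega : j - i ≤ m)

/-- Two non-backtracking sequences of the same length from `z 0 = w 0` with different first steps
do not end at the same vertex if the girth is large. -/
lemma egirth_le_of_two_seqs {m : ℕ} {z w : ℕ → V} (hz : IsNonBacktrackingSeq G (m + 1) z)
    (hw : IsNonBacktrackingSeq G (m + 1) w) (h0 : z 0 = w 0) (h1 : z 1 ≠ w 1)
    (hend : z (m + 1) = w (m + 1)) : G.egirth ≤ (2 * (m + 1) : ℕ) := by
  -- The reversal of `z` followed by `w` is closed, and the different first steps prevent
  -- backtracking at the junction.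
  set c : ℕ → V := fun i => if i ≤ m + 1 then z (m + 1 - i) else w (i - (m + 1)) with hc
  have hc1 : ∀ i ≤ m + 1, c i = z (m + 1 - i) := fun i hi => if_pos hi
  have hc2 : ∀ i, m + 1 ≤ i → c i = w (i - (m + 1)) := by
    intro i hi
    rcases hi.eq_or_lt with rfl | hi
    · rw [hc1 _ le_rfl, Nat.sub_self, h0]
    · exact if_neg (by omega)
  refine IsNonBacktrackingSeq.egirth_le (z := c) ⟨fun i hi => ?_, fun i hi => ?_⟩ (by omega) ?_
  · by_cases him : i < m + 1
    · rw [hc1 i (by omega), hc1 (i + 1) (by omega)]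
      have := hz.1 (m + 1 - (i + 1)) (by omega)
      rw [show m + 1 - (i + 1) + 1 = m + 1 - i by omega] at this
      exact this.symm
    · rw [hc2 i (by omega), hc2 (i + 1) (by omega)]
      have := hw.1 (i - (m + 1)) (by omega)
      rwa [show i - (m + 1) + 1 = i + 1 - (m + 1) by omega] at this
  · rcases lt_trichotomy (i + 1) (m + 1) with him | him | him
    · rw [hc1 i (by omega), hc1 (i + 2) (by omega)]
      have := hz.2 (m + 1 - (i + 2)) (by omega)
      rw [show m + 1 - (i + 2) + 2 = m + 1 - i by omega] at this
      exact this.symm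
    · rw [hc1 i (by omega), hc2 (i + 2) (by omega), show m + 1 - i = 1 by omega,
        show i + 2 - (m + 1) = 1 by omega]
      exact h1.symm
    · rw [hc2 i (by omega), hc2 (i + 2) (by omega)]
      have := hw.2 (i - (m + 1)) (by omega)
      rwa [show i - (m + 1) + 2 = i + 2 - (m + 1) by omega] at this
  · rw [hc1 0 (by omega), hc2 _ (by omega), Nat.sub_zero, hend]
    congr 1; omega

variable [Fintype V] [DecidableEq V] [DecidableRel G.Adj]

/-- The number of non-backtracking walks with `m` steps from `x` to `v` whose first step does not
go to `u`. -/
noncomputable def nbFrom (G : SimpleGraph V) [DecidableRel G.Adj] : ℕ → V → V → V → ℝ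
  | 0, _, x, v => if x = v then 1 else 0
  | m + 1, u, x, v => ∑ y ∈ (G.neighborFinset x).erase u, nbFrom G m x y v

/-- The number of non-backtracking walks with `m` steps from `x` to `v`. -/
noncomputable def nbCount (G : SimpleGraph V) [DecidableRel G.Adj] : ℕ → V → V → ℝ
  | 0, x, v => if x = v then 1 else 0
  | m + 1, x, v => ∑ y ∈ G.neighborFinset x, nbFrom G m x y v

lemma nbFrom_nonneg (m : ℕ) (u x v : V) : 0 ≤ nbFrom G m u x v := by
  induction m generalizing u x with
  | zero => simp only [nbFrom]; split_ifs <;> simp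
  | succ m ih => exact Finset.sum_nonneg fun y _ => ih x y

lemma nbFrom_le_nbCount (m : ℕ) (u x v : V) : nbFrom G m u x v ≤ nbCount G m x v := by
  cases m with
  | zero => exact le_rfl
  | succ m =>
    exact Finset.sum_le_sum_of_subset_of_nonneg (Finset.erase_subset _ _)
      fun y _ _ => nbFrom_nonneg m x y v

lemma exists_seq_of_nbFrom_ne_zero {m : ℕ} {u x v : V} (hux : G.Adj u x)
    (h : nbFrom G m u x v ≠ 0) : ∃ z, IsNonBacktrackingSeq G (m + 1) z ∧ z 0 = u ∧ z 1 = x ∧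
      z (m + 1) = v := by
  induction m generalizing u x with
  | zero =>
    have hxv : x = v := by
      by_contra hne
      exact h (by simp [nbFrom, hne])
    refine ⟨fun i => if i = 0 then u else x, ⟨fun i hi => ?_, fun i hi => by omega⟩, ?_⟩
    · obtain rfl : i = 0 := by omega
      simpa using hux
    · simp [hxv]
  | succ m ih =>
    obtain ⟨y, hy, hne⟩ := Finset.exists_ne_zero_of_sum_ne_zero h
    rw [Finset.mem_erase, SimpleGraph.mem_neighborFinset] at hy
    obtain ⟨z, hz, hz0, hz1, hzm⟩ := ih hy.2 hne
    refine ⟨fun i => if i = 0 then u else z (i - 1), ⟨fun i hi => ?_, fun i hi => ?_⟩,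
      by simp, by simp [hz0], by simp [hzm]⟩
    · rcases Nat.eq_zero_or_pos i with rfl | hi0
      · simpa [hz0] using hux
      · have := hz.1 (i - 1) (by omega)
        rw [show i - 1 + 1 = i by omega] at this
        simpa [show i ≠ 0 by omega] using this
    · rcases Nat.eq_zero_or_pos i with rfl | hi0
      · simpa [hz1] using hy.1
      · have := hz.2 (i - 1) (by omega)
        rw [show i - 1 + 2 = i + 1 by omega] at this
        simpa [show i ≠ 0 by omega] using this

lemma nbCount_self_eq_zero {m : ℕ} (h : ((m + 1 : ℕ) : ℕ∞) < G.egirth) (x : V) :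
    nbCount G (m + 1) x x = 0 := by
  refine Finset.sum_eq_zero fun y hy => ?_
  by_contra hne
  obtain ⟨z, hz, hz0, -, hzm⟩ :=
    exists_seq_of_nbFrom_ne_zero ((G.mem_neighborFinset x y).1 hy) hne
  exact absurd (hz.egirth_le (by omega) (hz0.trans hzm.symm)) (not_le.2 h)

/-- Two different first steps leading to `v` would close up to a cycle of length at most `2 * (m +
1)`, so at most one summand is nonzero. -/
lemma sum_nbFrom_le_one {m : ℕ} (h : ((2 * (m + 1) : ℕ) : ℕ∞) < G.egirth) {x v : V} {s : Finset V}
    (hs : s ⊆ G.neighborFinset x) (hle : ∀ y ∈ s, nbFrom G m x y v ≤ 1) :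
    ∑ y ∈ s, nbFrom G m x y v ≤ 1 := by
  by_cases hall : ∀ y ∈ s, nbFrom G m x y v = 0
  · rw [Finset.sum_eq_zero hall]; exact zero_le_one
  · push Not at hall
    obtain ⟨y, hy, hne⟩ := hall
    rw [Finset.sum_eq_single_of_mem y hy]
    · exact hle y hy
    · intro y' hy' hyy
      by_contra hne'
      have hadj := fun a (ha : a ∈ s) => (G.mem_neighborFinset x a).1 (hs ha)
      obtain ⟨z, hz, hz0, hz1, hzm⟩ := exists_seq_of_nbFrom_ne_zero (hadj y hy) hne
      obtain ⟨w, hw, hw0, hw1, hwm⟩ := exists_seq_of_nbFrom_ne_zero (hadj y' hy') hne'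
      exact absurd (egirth_le_of_two_seqs hz hw (hz0.trans hw0.symm)
        (by rw [hz1, hw1]; exact hyy.symm) (hzm.trans hwm.symm)) (not_le.2 h)

lemma nbFrom_le_one {m : ℕ} (h : ((2 * m : ℕ) : ℕ∞) < G.egirth) (u x v : V) :
    nbFrom G m u x v ≤ 1 := by
  induction m generalizing u x with
  | zero => simp only [nbFrom]; split_ifs <;> simp
  | succ m ih =>
    have h' : ((2 * m : ℕ) : ℕ∞) < G.egirth :=
      lt_of_le_of_lt (by exact_mod_cast (by omega : 2 * m ≤ 2 * (m + 1))) h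
    exact sum_nbFrom_le_one h (Finset.erase_subset _ _) fun y _ => ih h' x y

lemma nbCount_le_one {m : ℕ} (h : ((2 * m : ℕ) : ℕ∞) < G.egirth) (x v : V) :
    nbCount G m x v ≤ 1 := by
  cases m with
  | zero => simp only [nbCount]; split_ifs <;> simp
  | succ m =>
    have h' : ((2 * m : ℕ) : ℕ∞) < G.egirth :=
      lt_of_le_of_lt (by exact_mod_cast (by omega : 2 * m ≤ 2 * (m + 1))) h
    exact sum_nbFrom_le_one h le_rfl fun y _ => nbFrom_le_one h' x y v

lemma nbFrom_succ_eq {m : ℕ} {x y : V} (v : V) (h : G.Adj x y) :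
    nbFrom G (m + 1) x y v = nbCount G (m + 1) y v - nbFrom G m y x v := by
  rw [nbFrom, nbCount, Finset.sum_erase_eq_sub]
  exact (G.mem_neighborFinset y x).2 h.symm

lemma nbCount_one (x v : V) :
    nbCount G 1 x v = ∑ y ∈ G.neighborFinset x, nbCount G 0 y v := rfl

lemma nbCount_two {k : ℕ} (hreg : G.IsRegularOfDegree k) (x v : V) :
    nbCount G 2 x v = ∑ y ∈ G.neighborFinset x, nbCount G 1 y v - k * nbCount G 0 x v := by
  have h : nbCount G 2 x v = ∑ y ∈ G.neighborFinset x, nbFrom G (0 + 1) x y v := rfl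
  rw [h, Finset.sum_congr rfl fun y hy =>
    nbFrom_succ_eq v ((G.mem_neighborFinset x y).1 hy), Finset.sum_sub_distrib]
  simp [nbFrom, nbCount, hreg x]

/-- From all continuations after a first step one subtracts those that step back at once; a second
subtraction removes the walks overcounted in this way, which turns `k` into `k - 1`. At length two
there is no second subtraction, hence the separate `nbCount_two`. -/
lemma nbCount_add_three {k : ℕ} (hreg : G.IsRegularOfDegree k) (m : ℕ) (x v : V) :
    nbCount G (m + 3) x v = ∑ y ∈ G.neighborFinset x, nbCount G (m + 2) y v -
      ((k : ℝ) - 1) * nbCount G (m + 1) x v := by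
  rw [nbCount, Finset.sum_congr rfl fun y hy =>
    nbFrom_succ_eq v ((G.mem_neighborFinset x y).1 hy), Finset.sum_sub_distrib]
  rw [Finset.sum_congr (g := fun y => nbCount G (m + 1) x v - nbFrom G m x y v) rfl fun y hy =>
    nbFrom_succ_eq v ((G.mem_neighborFinset x y).1 hy).symm, Finset.sum_sub_distrib,
    Finset.sum_const, G.card_neighborFinset_eq_degree, hreg x, ← nbCount]
  simp only [nsmul_eq_mul]
  ring

omit [DecidableEq V] in
lemma sum_sum_neighbor {k : ℕ} (hreg : G.IsRegularOfDegree k) (f : V → ℝ) :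
    ∑ x, ∑ y ∈ G.neighborFinset x, f y = k * ∑ x, f x := by
  rw [Finset.sum_comm' (t' := Finset.univ) (s' := fun y => G.neighborFinset y)]
  · simp [hreg _, Finset.mul_sum]
  · simp [SimpleGraph.adj_comm]

lemma sum_nbCount {k : ℕ} (hreg : G.IsRegularOfDegree k) (m : ℕ) (v : V) :
    ∑ x, nbCount G (m + 1) x v = k * ((k : ℝ) - 1) ^ m := by
  have h0 : ∑ x, nbCount G 0 x v = 1 := by simp [nbCount]
  have h1 : ∑ x, nbCount G 1 x v = k := by
    simp only [nbCount_one, sum_sum_neighbor hreg, h0, mul_one]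
  have h2 : ∑ x, nbCount G 2 x v = k * ((k : ℝ) - 1) := by
    simp only [nbCount_two hreg, Finset.sum_sub_distrib, sum_sum_neighbor hreg, ← Finset.mul_sum,
      h0, h1]
    ring
  induction m using Nat.twoStepInduction with
  | zero => simpa using h1
  | one => simpa using h2
  | more m ih1 ih2 =>
    simp only [nbCount_add_three hreg, Finset.sum_sub_distrib, sum_sum_neighbor hreg,
      ← Finset.mul_sum]
    rw [ih1, show m + 2 = m + 1 + 1 by ring, ih2]
    ring

lemma walkExp_le_nbFrom {k : ℕ} (hk : 3 ≤ k) (hreg : G.IsRegularOfDegree k) (m t : ℕ)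
    (x : ℕ → V) (v : V) :
    walkExp G m (t + 2) x (fun x' => ind (x' (t + 1 + m) = v)) ≤
      (((k : ℝ) - 1) ^ m)⁻¹ * nbFrom G m (x t) (x (t + 1)) v := by
  have hk1 : (0 : ℝ) < (k : ℝ) - 1 := by
    have : (3 : ℝ) ≤ k := by exact_mod_cast hk
    linarith
  induction m generalizing t x with
  | zero => simp [walkExp, nbFrom, ind_eq_ite]
  | succ m ih =>
    have hcard : (k : ℝ) - 1 ≤ (nextSet G (t + 2) x).card := by
      have := Finset.pred_card_le_card_erase (s := G.neighborFinset (x (t + 1))) (a := x t)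
      rw [G.card_neighborFinset_eq_degree, hreg (x (t + 1))] at this
      have h2 : k ≤ (nextSet G (t + 2) x).card + 1 := by rw [nextSet]; omega
      have h3 : (k : ℝ) ≤ (nextSet G (t + 2) x).card + 1 := by exact_mod_cast h2
      linarith
    simp only [walkExp]
    have hstep : ∀ w ∈ nextSet G (t + 2) x, walkExp G m (t + 2 + 1) (Function.update x (t + 2) w)
        (fun x' => ind (x' (t + 1 + (m + 1)) = v)) ≤
        (((k : ℝ) - 1) ^ m)⁻¹ * nbFrom G m (x (t + 1)) w v := by
      intro w _
      have := ih (t + 1) (Function.update x (t + 2) w)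
      rw [Function.update_self, update_agree x w (by omega)] at this
      rw [show t + 1 + (m + 1) = t + 1 + 1 + m by ring]
      exact this
    calc _ ≤ (∑ w ∈ nextSet G (t + 2) x, (((k : ℝ) - 1) ^ m)⁻¹ * nbFrom G m (x (t + 1)) w v) /
          (nextSet G (t + 2) x).card :=
          div_le_div_of_nonneg_right (Finset.sum_le_sum hstep) (Nat.cast_nonneg _)
      _ ≤ (∑ w ∈ nextSet G (t + 2) x, (((k : ℝ) - 1) ^ m)⁻¹ * nbFrom G m (x (t + 1)) w v) /
          ((k : ℝ) - 1) :=
          div_le_div_of_nonneg_left (Finset.sum_nonneg fun w _ =>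
            mul_nonneg (by positivity) (nbFrom_nonneg _ _ _ _)) hk1 hcard
      _ = _ := by
          rw [← Finset.mul_sum, nbFrom, nextSet, pow_succ, mul_inv]
          ring

lemma walkExp_le_nbCount {k : ℕ} (hk : 3 ≤ k) (hreg : G.IsRegularOfDegree k) (m t : ℕ)
    (x : ℕ → V) (v : V) :
    walkExp G m (t + 1) x (fun x' => ind (x' (t + m) = v)) ≤
      (((k : ℝ) - 1) ^ m)⁻¹ * nbCount G m (x t) v := by
  have hk1 : (0 : ℝ) < (k : ℝ) - 1 := by
    have : (3 : ℝ) ≤ k := by exact_mod_cast hk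
    linarith
  match t with
  | t + 1 =>
    exact (walkExp_le_nbFrom hk hreg m t x v).trans
      (mul_le_mul_of_nonneg_left (nbFrom_le_nbCount m _ _ _) (by positivity))
  | 0 =>
    cases m with
    | zero => simp [walkExp, nbCount, ind_eq_ite]
    | succ m =>
      simp only [walkExp]
      have hcard : ((nextSet G (0 + 1) x).card : ℝ) = k := by
        rw [nextSet, G.card_neighborFinset_eq_degree, hreg (x 0)]
      have hstep : ∀ w ∈ nextSet G (0 + 1) x, walkExp G m (0 + 1 + 1)
          (Function.update x (0 + 1) w) (fun x' => ind (x' (0 + (m + 1)) = v)) ≤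
          (((k : ℝ) - 1) ^ m)⁻¹ * nbFrom G m (x 0) w v := by
        intro w _
        have := walkExp_le_nbFrom hk hreg m 0 (Function.update x (0 + 1) w) v
        rw [Function.update_self, update_agree x w (by omega)] at this
        rw [show 0 + (m + 1) = 0 + 1 + m by ring]
        exact this
      calc _ ≤ (∑ w ∈ nextSet G (0 + 1) x, (((k : ℝ) - 1) ^ m)⁻¹ * nbFrom G m (x 0) w v) /
            (nextSet G (0 + 1) x).card :=
            div_le_div_of_nonneg_right (Finset.sum_le_sum hstep) (Nat.cast_nonneg _)
        _ ≤ (∑ w ∈ nextSet G (0 + 1) x, (((k : ℝ) - 1) ^ m)⁻¹ * nbFrom G m (x 0) w v) /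
            ((k : ℝ) - 1) :=
            div_le_div_of_nonneg_left (Finset.sum_nonneg fun w _ =>
              mul_nonneg (by positivity) (nbFrom_nonneg _ _ _ _)) hk1 (by rw [hcard]; linarith)
        _ = _ := by
            rw [← Finset.mul_sum, nbCount, nextSet, pow_succ, mul_inv]
            ring

/-- Averaging over the uniform start sums the walks ending at `v`. The factor `k / (k - 1)` is the
loss from bounding the first step by `1 / (k - 1)` instead of `1 / k`; it covers times too early for
mixing. -/
lemma walkExp_zero_le {k : ℕ} (hk : 3 ≤ k) (hreg : G.IsRegularOfDegree k) (m : ℕ)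
    (x : ℕ → V) (v : V) :
    walkExp G (m + 1) 0 x (fun x' => ind (x' m = v)) ≤ (k / ((k : ℝ) - 1)) / Fintype.card V := by
  have hk1 : (0 : ℝ) < (k : ℝ) - 1 := by
    have : (3 : ℝ) ≤ k := by exact_mod_cast hk
    linarith
  simp only [walkExp, nextSet, Finset.card_univ]
  refine div_le_div_of_nonneg_right ?_ (Nat.cast_nonneg _)
  calc ∑ w, walkExp G m (0 + 1) (Function.update x 0 w) (fun x' => ind (x' m = v))
      ≤ ∑ w, (((k : ℝ) - 1) ^ m)⁻¹ * nbCount G m w v := by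
        refine Finset.sum_le_sum fun w _ => ?_
        have := walkExp_le_nbCount hk hreg m 0 (Function.update x 0 w) v
        rwa [Function.update_self, zero_add m] at this
    _ = (((k : ℝ) - 1) ^ m)⁻¹ * ∑ w, nbCount G m w v := by rw [Finset.mul_sum]
    _ ≤ k / ((k : ℝ) - 1) := by
        cases m with
        | zero =>
          simp only [pow_zero, inv_one, one_mul, nbCount, Finset.sum_ite_eq', Finset.mem_univ,
            if_true]
          rw [one_le_div hk1]; linarith
        | succ m =>
          rw [sum_nbCount hreg, pow_succ]
          exact le_of_eq (by field_simp)

/-- Large girth makes returns unlikely. -/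
lemma returnsAtMost_of_girth {k : ℕ} (hk : 3 ≤ k) (hreg : G.IsRegularOfDegree k) [Nonempty V]
    {ρ : ℕ} (hρ : ((2 * ρ + 1 : ℕ) : ℕ∞) < G.egirth) :
    ReturnsAtMost G (((k : ℝ) - 1) ^ ρ)⁻¹ := by
  have hk1 : (0 : ℝ) < (k : ℝ) - 1 := by
    have : (3 : ℝ) ≤ k := by exact_mod_cast hk
    linarith
  have hG := nextSet_nonempty hk hreg
  intro s t x hst
  -- Short closed non-backtracking walks do not exist. For longer ones only the last `ρ` steps
  -- matter: at most one walk of length `ρ` joins two given vertices.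
  by_cases h : t - s ≤ ρ
  · have h1 := walkExp_le_nbCount hk hreg (t - s) s x (x s)
    rw [show s + (t - s) = t by omega] at h1
    obtain ⟨m, hm⟩ := Nat.exists_eq_succ_of_ne_zero (by omega : t - s ≠ 0)
    have h2 : nbCount G (t - s) (x s) (x s) = 0 := by
      rw [hm]
      refine nbCount_self_eq_zero (lt_of_le_of_lt ?_ hρ) (x s)
      exact_mod_cast (by omega : m + 1 ≤ 2 * ρ + 1)
    rw [h2, mul_zero] at h1
    exact h1.trans (by positivity)
  · refine walkExp_le_of_forall_le hG (a := t - s - ρ) (by omega) fun x' hx' => ?_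
    rw [show t - s - (t - s - ρ) = ρ by omega, show s + 1 + (t - s - ρ) = t - ρ + 1 by omega]
    have h1 := walkExp_le_nbCount hk hreg ρ (t - ρ) x' (x s)
    rw [show t - ρ + ρ = t by omega] at h1
    refine h1.trans (mul_le_of_le_one_right (by positivity) (nbCount_le_one ?_ _ _))
    exact lt_of_le_of_lt (by exact_mod_cast (by omega : 2 * ρ ≤ 2 * ρ + 1)) hρ

lemma mixesWithin_of_nbCount_le {k : ℕ} (hk : 3 ≤ k) (hreg : G.IsRegularOfDegree k) {τ : ℕ}
    {μ : ℝ} (hμ : (k / ((k : ℝ) - 1)) / Fintype.card V ≤ μ)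
    (h : ∀ x v : V, (((k : ℝ) - 1) ^ τ)⁻¹ * nbCount G τ x v ≤ μ) : MixesWithin G τ μ := by
  intro t x v
  by_cases ht : τ ≤ t
  · have := walkExp_le_nbCount hk hreg τ (t - τ) x v
    rw [show t - τ + τ = t by omega] at this
    rw [show t + 1 - (t + 1 - τ) = τ by omega, show t + 1 - τ = t - τ + 1 by omega]
    exact this.trans (h _ _)
  · rw [show t + 1 - τ = 0 by omega, Nat.sub_zero]
    exact (walkExp_zero_le hk hreg t x v).trans hμ

end NonBacktracking

/-! ### Spectral estimate of the number of non-backtracking walks. -/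

/-- A nonreal root has squared modulus equal to the product `q` of the two conjugate roots. For a
real root the bound on `μ` puts `|z|` between `q / r` and `r`. -/
lemma norm_root_le {z : ℂ} {μ q r : ℝ} (hr : 0 < r) (hqr : q ≤ r ^ 2) (hμ : |μ| ≤ r + q / r)
    (hz : z ^ 2 - μ * z + q = 0) : ‖z‖ ≤ r := by
  have hre := congrArg Complex.re hz
  have him := congrArg Complex.im hz
  simp [sq] at hre him
  have hnorm : ‖z‖ ^ 2 = z.re ^ 2 + z.im ^ 2 := by
    rw [← Complex.normSq_eq_norm_sq, Complex.normSq_apply]; ring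
  refine abs_le_of_sq_le_sq' ?_ hr.le |>.2
  rw [hnorm]
  by_cases hb : z.im = 0
  · rw [hb] at hre ⊢
    have h1 : z.re ^ 2 + q = μ * z.re := by linarith
    have h2 : μ * z.re ≤ (r + q / r) * |z.re| := by
      calc μ * z.re ≤ |μ * z.re| := le_abs_self _
        _ = |μ| * |z.re| := abs_mul _ _
        _ ≤ _ := mul_le_mul_of_nonneg_right hμ (abs_nonneg _)
    have h3 : (|z.re| - r) * (|z.re| - q / r) ≤ 0 := by
      have : r * (q / r) = q := by field_simp
      have h4 := sq_abs z.re
      nlinarith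
    have hqr' : q / r ≤ r := by
      rw [div_le_iff₀ hr]; linarith [sq r]
    have h5 : |z.re| ≤ r := by
      by_contra hlt
      push Not at hlt
      have := mul_pos (sub_pos.2 hlt) (sub_pos.2 (hqr'.trans_lt hlt))
      linarith
    have := sq_le_sq' (by linarith [abs_nonneg z.re]) h5
    rw [sq_abs] at this
    linarith
  · have h1 : 2 * z.re = μ := by
      have : z.im * (2 * z.re - μ) = 0 := by linarith
      have := (mul_eq_zero.1 this).resolve_left hb
      linarith
    rw [← h1] at hre
    nlinarith

/-- Growth of the solutions of the recurrence satisfied by non-backtracking walk counts. -/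
lemma abs_recurrence_le {c : ℕ → ℝ} {μ k q r : ℝ} (hk : 0 ≤ k) (hr : 1 ≤ r)
    (hqr : q ≤ r ^ 2) (hμ : |μ| ≤ r + q / r) (h1 : c 1 = μ * c 0) (h2 : c 2 = μ * c 1 - k * c 0)
    (h3 : ∀ m, c (m + 3) = μ * c (m + 2) - q * c (m + 1)) (m : ℕ) :
    |c (m + 1)| ≤ (6 * r ^ 2 + k) * (m + 1) * r ^ m * |c 0| := by
  have hr0 : 0 < r := by linarith
  obtain ⟨w, hw⟩ := IsAlgClosed.exists_pow_nat_eq ((μ : ℂ) ^ 2 - 4 * q) (n := 2) (by norm_num)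
  set θ₁ : ℂ := (μ + w) / 2 with hθ₁
  set θ₂ : ℂ := (μ - w) / 2 with hθ₂
  have hsum : (μ : ℂ) = θ₁ + θ₂ := by rw [hθ₁, hθ₂]; ring
  have hprod : (q : ℂ) = θ₁ * θ₂ := by
    rw [hθ₁, hθ₂]; linear_combination (1 / 4 : ℂ) * hw
  have hn1 : ‖θ₁‖ ≤ r := norm_root_le hr0 hqr hμ (by rw [hsum, hprod]; ring)
  have hn2 : ‖θ₂‖ ≤ r := norm_root_le hr0 hqr hμ (by rw [hsum, hprod]; ring)
  have hμr : |μ| ≤ 2 * r := by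
    have : q / r ≤ r := by rw [div_le_iff₀ hr0]; linarith [sq r]
    linarith
  have hc1 : |c 1| ≤ 2 * r * |c 0| := by
    rw [h1, abs_mul]; exact mul_le_mul_of_nonneg_right hμr (abs_nonneg _)
  have hc2 : |c 2| ≤ (4 * r ^ 2 + k) * |c 0| := by
    calc |c 2| ≤ |μ * c 1| + |k * c 0| := by rw [h2]; exact abs_sub _ _
      _ = |μ| * |c 1| + k * |c 0| := by rw [abs_mul, abs_mul, abs_of_nonneg hk]
      _ ≤ (2 * r) * (2 * r * |c 0|) + k * |c 0| := by gcongr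
      _ = _ := by ring
  set D := (6 * r ^ 2 + k) * |c 0| with hD
  have hD0 : 0 ≤ D := by positivity
  -- Factoring the recurrence through one root leaves a geometric sequence with ratio `θ₁`. No
  -- division by `θ₁ - θ₂` occurs, so equal roots need no separate case; the price is the linear
  -- factor `m + 1`.
  have hd : ∀ m, ‖(c (m + 2) : ℂ) - θ₂ * c (m + 1)‖ ≤ r ^ m * D := by
    intro m
    induction m with
    | zero =>
      calc ‖(c (0 + 2) : ℂ) - θ₂ * c (0 + 1)‖ ≤ ‖(c 2 : ℂ)‖ + ‖θ₂ * c 1‖ := norm_sub_le _ _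
        _ = |c 2| + ‖θ₂‖ * |c 1| := by simp
        _ ≤ (4 * r ^ 2 + k) * |c 0| + r * (2 * r * |c 0|) := by gcongr
        _ = r ^ 0 * D := by rw [hD]; ring
    | succ m ih =>
      have : (c (m + 3) : ℂ) - θ₂ * c (m + 2) = θ₁ * ((c (m + 2) : ℂ) - θ₂ * c (m + 1)) := by
        rw [h3]; push_cast; rw [hsum, hprod]; ring
      calc ‖(c (m + 1 + 2) : ℂ) - θ₂ * c (m + 1 + 1)‖
          = ‖θ₁‖ * ‖(c (m + 2) : ℂ) - θ₂ * c (m + 1)‖ := by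
            rw [← norm_mul, ← this]
        _ ≤ r * (r ^ m * D) := by gcongr
        _ = r ^ (m + 1) * D := by ring
  have main : |c (m + 1)| ≤ (m + 1) * r ^ m * D := by
    induction m with
    | zero =>
      refine hc1.trans ?_
      have : 2 * r ≤ 6 * r ^ 2 + k := by nlinarith
      simpa [hD] using mul_le_mul_of_nonneg_right this (abs_nonneg (c 0))
    | succ m ih =>
      have h4 : |c (m + 2)| ≤ r ^ m * D + r * |c (m + 1)| := by
        calc |c (m + 2)| = ‖((c (m + 2) : ℂ) - θ₂ * c (m + 1)) + θ₂ * c (m + 1)‖ := by simp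
          _ ≤ _ := norm_add_le _ _
          _ ≤ r ^ m * D + r * |c (m + 1)| := by
            refine add_le_add (hd m) ?_
            rw [norm_mul, Complex.norm_real, Real.norm_eq_abs]
            gcongr
      have h5 : r ^ m * D ≤ r ^ (m + 1) * D :=
        mul_le_mul_of_nonneg_right (pow_le_pow_right₀ hr (Nat.le_succ m)) hD0
      calc |c (m + 1 + 1)| ≤ r ^ (m + 1) * D + r * ((m + 1) * r ^ m * D) :=
            h4.trans (add_le_add h5 (by gcongr))
        _ = ((m + 1 : ℕ) + 1) * r ^ (m + 1) * D := by push_cast; ring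
  calc _ ≤ _ := main
    _ = _ := by rw [hD]; ring

section Spectral

variable {V : Type*} [Fintype V] [DecidableEq V] {G : SimpleGraph V} [DecidableRel G.Adj]

/-- An orthonormal eigenbasis of the adjacency matrix, one of whose eigenvalues is set apart while
the others are bounded by `secondEigenvalue`. -/
lemma exists_eigenbasis (hV : 1 < Fintype.card V) :
    ∃ (e : OrthonormalBasis V ℝ (EuclideanSpace ℝ V)) (μ : V → ℝ) (j₀ : V),
      (∀ j x, ∑ y ∈ G.neighborFinset x, e j y = μ j * e j x) ∧
      (∀ j, j ≠ j₀ → |μ j| ≤ secondEigenvalue G) ∧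
      ∃ j, |μ j| = secondEigenvalue G ∨ μ j = secondEigenvalue G := by
  set hA := G.isHermitian_adjMatrix ℝ with hAdef
  set φ : Fin (Fintype.card V) ≃ V := Fintype.equivOfCardEq (Fintype.card_fin _) with hφ
  -- This holds by definition because `φ` is the very equivalence used to define `eigenvalues`.
  have hev : ∀ j, hA.eigenvalues j = hA.eigenvalues₀ (φ.symm j) := fun j => rfl
  refine ⟨hA.eigenvectorBasis, hA.eigenvalues, φ ⟨0, by omega⟩, fun j x => ?_, fun j hj => ?_, ?_⟩
  · have := congrFun (hA.mulVec_eigenvectorBasis j) x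
    rw [SimpleGraph.adjMatrix_mulVec_apply] at this
    simpa using this
  · rw [secondEigenvalue, dif_pos hV, hev]
    have hne : φ.symm j ≠ ⟨0, by omega⟩ := fun h => hj (by rw [← h, φ.apply_symm_apply])
    have h1 : (⟨1, hV⟩ : Fin (Fintype.card V)) ≤ φ.symm j := by
      rw [Fin.le_def]
      have : (φ.symm j).val ≠ 0 := fun h => hne (Fin.ext h)
      show 1 ≤ (φ.symm j).val
      omega
    have h2 : φ.symm j ≤ (⟨Fintype.card V - 1, by omega⟩ : Fin (Fintype.card V)) := by
      rw [Fin.le_def]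
      have := (φ.symm j).isLt
      show (φ.symm j).val ≤ Fintype.card V - 1
      omega
    have h3 := hA.eigenvalues₀_antitone h1
    have h4 := hA.eigenvalues₀_antitone h2
    rw [abs_le]
    refine ⟨?_, h3.trans (le_max_left _ _)⟩
    have h5 := le_max_right (hA.eigenvalues₀ ⟨1, hV⟩)
      |hA.eigenvalues₀ ⟨Fintype.card V - 1, by omega⟩|
    have h6 := neg_abs_le (hA.eigenvalues₀ ⟨Fintype.card V - 1, by omega⟩)
    linarith
  · rw [secondEigenvalue, dif_pos hV]
    rcases max_choice (hA.eigenvalues₀ ⟨1, hV⟩)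
      |hA.eigenvalues₀ ⟨Fintype.card V - 1, by omega⟩| with h | h
    · exact ⟨φ ⟨1, hV⟩, Or.inr (by rw [h, hev, φ.symm_apply_apply])⟩
    · exact ⟨φ ⟨Fintype.card V - 1, by omega⟩, Or.inl (by rw [h, hev, φ.symm_apply_apply])⟩

omit [DecidableEq V] in
lemma sum_mul_sum_neighbor {e : V → ℝ} {μ : ℝ}
    (he : ∀ x, ∑ y ∈ G.neighborFinset x, e y = μ * e x) (f : V → ℝ) :
    ∑ x, e x * ∑ y ∈ G.neighborFinset x, f y = μ * ∑ x, e x * f x := by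
  simp only [Finset.mul_sum]
  rw [Finset.sum_comm' (t' := Finset.univ) (s' := fun y => G.neighborFinset y)
    (by simp [SimpleGraph.adj_comm])]
  refine Finset.sum_congr rfl fun y _ => ?_
  rw [← Finset.sum_mul, he]; ring

/-- Evaluating the eigenvalue equation where an eigenvector is largest in absolute value gives `|μ|
≤ k`. This uniform bound is what makes the real-valued `limsup` usable later. -/
lemma secondEigenvalue_le {k : ℕ} (hreg : G.IsRegularOfDegree k) :
    secondEigenvalue G ≤ k := by
  by_cases hV : 1 < Fintype.card V
  · obtain ⟨e, μ, -, he, -, j, hj⟩ := exists_eigenbasis (G := G) hV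
    have hle : |μ j| ≤ k := by
      have : Nonempty V := Fintype.card_pos_iff.1 (by omega)
      obtain ⟨x, hx⟩ := Finite.exists_max fun x => |e j x|
      have hpos : 0 < |e j x| := by
        by_contra hcon
        have hzero : e j = 0 := by
          ext y
          have := (hx y).trans (not_lt.1 hcon)
          simpa using abs_nonpos_iff.1 this
        have := e.orthonormal.1 j
        rw [hzero, norm_zero] at this
        exact zero_ne_one this
      refine le_of_mul_le_mul_right ?_ hpos
      calc |μ j| * |e j x| = |∑ y ∈ G.neighborFinset x, e j y| := by rw [he, abs_mul]
        _ ≤ ∑ y ∈ G.neighborFinset x, |e j y| := Finset.abs_sum_le_sum_abs _ _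
        _ ≤ (G.neighborFinset x).card • |e j x| := Finset.sum_le_card_nsmul _ _ _ fun y _ => hx y
        _ = k * |e j x| := by rw [nsmul_eq_mul, G.card_neighborFinset_eq_degree, hreg x]
    rcases hj with hj | hj
    · rw [← hj]; exact hle
    · rw [← hj]; exact (le_abs_self _).trans hle
  · rw [secondEigenvalue, dif_neg hV]; positivity

/-- Non-backtracking walk counts on an expander are close to their mean. -/
lemma nbCount_le {k : ℕ} (hk : 3 ≤ k) (hreg : G.IsRegularOfDegree k) (hV : 1 < Fintype.card V)
    {r : ℝ} (hr : 1 ≤ r) (hqr : (k : ℝ) - 1 ≤ r ^ 2) (hlt : secondEigenvalue G < k)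
    (hsec : secondEigenvalue G ≤ r + ((k : ℝ) - 1) / r) (m : ℕ) (x v : V) :
    nbCount G (m + 1) x v ≤ k * ((k : ℝ) - 1) ^ m / Fintype.card V +
      (6 * r ^ 2 + k) * (m + 1) * r ^ m := by
  obtain ⟨e, μ, j₀, he, hμ, -⟩ := exists_eigenbasis (G := G) hV
  have hk1 : (0 : ℝ) < (k : ℝ) - 1 := by
    have : (3 : ℝ) ≤ k := by exact_mod_cast hk
    linarith
  have hn0 : (0 : ℝ) < Fintype.card V := by
    have : 0 < Fintype.card V := by omega
    exact_mod_cast this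
  set c : V → ℕ → ℝ := fun j m => ∑ x, e j x * nbCount G m x v with hc
  set B : ℝ := (6 * r ^ 2 + k) * (m + 1) * r ^ m with hB
  have hB0 : 0 ≤ B := by positivity
  have hc0 : ∀ j, c j 0 = e j v := fun j => by simp [hc, nbCount]
  have hexp : ∀ f : V → ℝ, ∀ x, f x = ∑ j, (∑ y, e j y * f y) * e j x := by
    intro f x
    have h1 := congrArg (fun g : EuclideanSpace ℝ V => g x) (e.sum_repr (WithLp.toLp 2 f))
    simp only [e.repr_apply_apply, PiLp.inner_apply, WithLp.ofLp_sum, WithLp.ofLp_smul,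
      Finset.sum_apply, Pi.smul_apply, smul_eq_mul, RCLike.inner_apply, conj_trivial] at h1
    rw [← h1]
    simp only [mul_comm]
  have hsq : ∀ x, ∑ j, e j x ^ 2 = 1 := by
    intro x
    have := hexp (fun y => if y = x then 1 else 0) x
    simp only [if_true, mul_ite, mul_one, mul_zero, Finset.sum_ite_eq', Finset.mem_univ] at this
    rw [this]
    exact Finset.sum_congr rfl fun j _ => sq _
  have hcbound : ∀ j, j ≠ j₀ → |c j (m + 1)| ≤ B * |e j v| := by
    intro j hj
    rw [← hc0]
    refine abs_recurrence_le (μ := μ j) (q := (k : ℝ) - 1) (Nat.cast_nonneg k) hr hqr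
      ((hμ j hj).trans hsec) ?_ ?_ ?_ m
    · simp only [hc, nbCount_one]
      exact sum_mul_sum_neighbor (he j) _
    · simp only [hc, nbCount_two hreg, mul_sub, Finset.sum_sub_distrib]
      rw [sum_mul_sum_neighbor (he j), Finset.mul_sum (s := Finset.univ) (a := (k : ℝ))]
      simp only [mul_left_comm]
    · intro l
      simp only [hc, nbCount_add_three hreg, mul_sub, Finset.sum_sub_distrib]
      rw [sum_mul_sum_neighbor (he j), Finset.mul_sum (s := Finset.univ) (a := (k : ℝ) - 1)]
      simp only [mul_left_comm]
  -- All other eigenvalues differ from `k`, the eigenvalue of the constants, so their eigenvectors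
  -- are orthogonal to the constants. Hence `e j₀` is constant and contributes exactly the mean;
  -- connectedness enters only through the strict spectral gap.
  have horth : ∀ j, j ≠ j₀ → ∑ y, e j y = 0 := by
    intro j hj
    have h1 := sum_mul_sum_neighbor (he j) fun _ => 1
    simp only [Finset.sum_const, G.card_neighborFinset_eq_degree, hreg _, nsmul_eq_mul, mul_one,
      ← Finset.sum_mul] at h1
    have h2 : μ j ≠ k := fun h => by
      have := (le_abs_self _).trans (hμ j hj)
      rw [h] at this
      linarith
    have h3 : (∑ y, e j y) * (k - μ j) = 0 := by linarith
    exact (mul_eq_zero.1 h3).resolve_right (sub_ne_zero.2 h2.symm)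
  set S := ∑ y, e j₀ y with hS
  have hone : ∀ x, S * e j₀ x = 1 := by
    intro x
    have := hexp (fun _ => 1) x
    simp only [mul_one] at this
    rw [this, Finset.sum_eq_single j₀]
    · intro j _ hj
      rw [horth j hj, zero_mul]
    · simp
  have hSS : S * S = Fintype.card V := by
    calc S * S = ∑ y, S * e j₀ y := by rw [← Finset.mul_sum]
      _ = Fintype.card V := by simp [hone]
  have hmain : c j₀ (m + 1) * e j₀ x = k * ((k : ℝ) - 1) ^ m / Fintype.card V := by
    rw [eq_div_iff hn0.ne', ← hSS, ← sum_nbCount hreg m v]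
    calc c j₀ (m + 1) * e j₀ x * (S * S) = (S * e j₀ x) * (S * c j₀ (m + 1)) := by ring
      _ = ∑ y, (S * e j₀ y) * nbCount G (m + 1) y v := by
        rw [hone, one_mul, hc, Finset.mul_sum]; simp only [mul_assoc]
      _ = _ := by simp [hone]
  rw [hexp (fun x => nbCount G (m + 1) x v) x,
    ← Finset.add_sum_erase _ _ (Finset.mem_univ j₀)]
  refine add_le_add hmain.le ?_
  -- The inequality between arithmetic and geometric means and `∑ j, e j x ^ 2 = 1` bound the
  -- remainder without a factor of the dimension.
  calc ∑ j ∈ Finset.univ.erase j₀, c j (m + 1) * e j x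
      ≤ ∑ j ∈ Finset.univ.erase j₀, B * ((e j v ^ 2 + e j x ^ 2) / 2) := by
        refine Finset.sum_le_sum fun j hj => ?_
        calc c j (m + 1) * e j x ≤ |c j (m + 1)| * |e j x| := by
              rw [← abs_mul]; exact le_abs_self _
          _ ≤ B * |e j v| * |e j x| := by
              gcongr; exact hcbound j (Finset.mem_erase.1 hj).1
          _ = B * (|e j v| * |e j x|) := by ring
          _ ≤ B * ((e j v ^ 2 + e j x ^ 2) / 2) := by
              refine mul_le_mul_of_nonneg_left ?_ hB0
              have := two_mul_le_add_sq |e j v| |e j x|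
              rw [sq_abs, sq_abs] at this
              linarith
    _ ≤ ∑ j, B * ((e j v ^ 2 + e j x ^ 2) / 2) :=
        Finset.sum_le_sum_of_subset_of_nonneg (Finset.erase_subset _ _)
          fun j _ _ => by positivity
    _ = B := by
        rw [← Finset.mul_sum, ← Finset.sum_div, Finset.sum_add_distrib, hsq, hsq]; ring

end Spectral

/-! ### The layered induction and the tail levels with explicit parameters. -/

section Asymptotics

/-- The threshold `40 * y` is twice the bound on the mean, and `20 - 40 * log 2 < -7`. -/
lemma exp_moment_bound {p y : ℝ} {M : ℕ} (hp : 0 ≤ p) (hM : p * M ≤ 20 * y) (hy : 0 ≤ y) :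
    (1 + p) ^ M * (2 : ℝ) ^ (-(40 * y)) ≤ Real.exp (-(7 * y)) := by
  have h1 : (1 + p) ^ M ≤ Real.exp (20 * y) := by
    calc (1 + p) ^ M ≤ (Real.exp p) ^ M := by
          gcongr
          linarith [Real.add_one_le_exp p]
      _ = Real.exp (p * M) := by rw [← Real.exp_nat_mul, mul_comm]
      _ ≤ _ := Real.exp_le_exp.2 hM
  rw [Real.rpow_def_of_pos (by norm_num)]
  calc _ ≤ Real.exp (20 * y) * Real.exp (Real.log 2 * (-(40 * y))) := by gcongr
    _ = Real.exp (20 * y + Real.log 2 * (-(40 * y))) := (Real.exp_add _ _).symm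
    _ ≤ _ := by
      refine Real.exp_le_exp.2 ?_
      nlinarith [Real.log_two_gt_d9]

variable {V : Type*} [Fintype V] [DecidableEq V] {G : SimpleGraph V} [DecidableRel G.Adj]
  {τ : ℕ} {η X : ℝ}

/-- The thresholds of the layered induction, as fractions of the number of bins. -/
noncomputable def layerFraction (X : ℝ) (j : ℕ) : ℝ := max ((1 / 2) ^ 2 ^ j / 40) X⁻¹

/-- The doubly exponential term solves the recursion with equality. The floor `X⁻¹` stops the
decrease where concentration would fail. -/
lemma layerFraction_succ {X : ℝ} (hX : 40 ≤ X) (j : ℕ) :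
    40 * layerFraction X j ^ 2 ≤ layerFraction X (j + 1) := by
  have hX0 : 0 < X := by linarith
  unfold layerFraction
  rcases max_choice ((1 / 2 : ℝ) ^ 2 ^ j / 40) X⁻¹ with h | h
  · rw [h]
    refine le_trans (le_of_eq ?_) (le_max_left _ _)
    rw [pow_succ 2 j, pow_mul]; ring
  · rw [h]
    refine le_trans ?_ (le_max_right _ _)
    have : 40 * X⁻¹ ≤ 1 := by rw [← div_eq_mul_inv, div_le_one hX0]; exact hX
    have h2 : 0 < X⁻¹ := inv_pos.2 hX0
    nlinarith

variable (hG : ∀ t (x : ℕ → V), (nextSet G t x).Nonempty)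
  (hM : MixesWithin G τ (3 / Fintype.card V)) (hR : ReturnsAtMost G η) (hη : 0 ≤ η)
  (hτ : 1 ≤ τ) (hX : 40 ≤ X) (hτX : τ ≤ X) (hXn : X ^ 4 ≤ Fintype.card V) (hηX : η ≤ (X ^ 4)⁻¹)
  (tie : TieRule V)

include hG hM hR hη hτ hX hτX hXn hηX

lemma pairExp_layer_le (i j : ℕ) (x y : ℕ → V) :
    pairExp G ((Fintype.card V / τ + 1) * τ) 0 x y (fun x' y' =>
      ind (((heavyBins tie x' y' i (Fintype.card V)).card : ℝ) ≤
          layerFraction X j * Fintype.card V ∧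
        layerFraction X (j + 1) * Fintype.card V <
          (heavyBins tie x' y' (i + 1) (Fintype.card V)).card)) ≤ X * Real.exp (-(7 * X)) := by
  set n := Fintype.card V with hn
  have hX0 : 0 < X := by linarith
  have hn0 : (0 : ℝ) < n := lt_of_lt_of_le (by positivity) hXn
  have hτ0 : (0 : ℝ) < τ := by exact_mod_cast hτ
  set β := layerFraction X j with hβ
  have hβX : X⁻¹ ≤ β := le_max_right _ _
  have hβ0 : 0 < β := lt_of_lt_of_le (inv_pos.2 hX0) hβX
  set a : ℝ := 40 * (β ^ 2 * n / τ) with ha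
  -- Mixing gives `9 β ^ 2`; the window error is at most `8 / X ^ 3`, absorbed in one more `β ^ 2`
  -- because `β ≥ 1 / X`.
  have hp : (β * n * (3 / n)) ^ 2 + τ * (2 * η + 2 * (3 / n)) ≤ 10 * β ^ 2 := by
    have h1 : β * n * (3 / n) = 3 * β := by field_simp
    have h2 : (3 : ℝ) / n ≤ 3 * (X ^ 4)⁻¹ := by
      rw [div_eq_mul_inv]; gcongr
    have h3 : τ * (2 * η + 2 * (3 / n)) ≤ X * (8 * (X ^ 4)⁻¹) := by
      refine mul_le_mul hτX (by linarith) (by positivity) hX0.le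
    have h4 : X * (8 * (X ^ 4)⁻¹) ≤ X⁻¹ ^ 2 := by
      have : X * (8 * (X ^ 4)⁻¹) = (8 * X⁻¹) * X⁻¹ ^ 2 := by field_simp
      rw [this]
      refine mul_le_of_le_one_left (by positivity) ?_
      rw [← div_eq_mul_inv, div_le_one hX0]; linarith
    have h5 : X⁻¹ ^ 2 ≤ β ^ 2 := by gcongr
    rw [h1]
    nlinarith
  have hnM : n ≤ (n / τ + 1) * τ := by
    rw [mul_comm]; exact (Nat.lt_mul_div_succ n hτ).le
  have hτn : (τ : ℝ) ≤ n := by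
    refine hτX.trans (le_trans ?_ hXn)
    exact le_self_pow₀ (by linarith) (by norm_num)
  have hMle : ((n / τ + 1 : ℕ) : ℝ) ≤ 2 * n / τ := by
    have h1 : ((n / τ : ℕ) : ℝ) ≤ n / τ := Nat.cast_div_le
    have h2 : (1 : ℝ) ≤ n / τ := (one_le_div hτ0).2 hτn
    push_cast
    rw [mul_div_assoc]
    linarith
  have haτ : a * τ ≤ layerFraction X (j + 1) * n := by
    calc a * τ = 40 * β ^ 2 * n := by rw [ha]; field_simp
      _ ≤ layerFraction X (j + 1) * n := by
        gcongr
        exact layerFraction_succ hX j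
  refine le_trans (pairExp_mono fun x' y' => ind_mono fun h => ⟨h.1, lt_of_le_of_lt haτ h.2⟩)
    ((pairExp_heavyBins_succ_le hG hM hR tie (by positivity) hη hτ hnM i hp (a := a) x y).trans ?_)
  -- The floor on `β`, with `n ≥ X ^ 4` and `τ ≤ X`, keeps the exponent at least `X`.
  · have hy : X ≤ β ^ 2 * n / τ := by
      rw [le_div_iff₀ hτ0]
      calc X * τ ≤ X * X := by gcongr
        _ = X⁻¹ ^ 2 * X ^ 4 := by field_simp
        _ ≤ β ^ 2 * n := by gcongr
    have hb := exp_moment_bound (p := 10 * β ^ 2) (y := β ^ 2 * n / τ) (M := n / τ + 1)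
      (by positivity) (by
        calc 10 * β ^ 2 * ((n / τ + 1 : ℕ) : ℝ) ≤ 10 * β ^ 2 * (2 * n / τ) := by gcongr
          _ = 20 * (β ^ 2 * n / τ) := by ring) (by positivity)
    refine mul_le_mul hτX (hb.trans (Real.exp_le_exp.2 ?_)) (by positivity) hX0.le
    linarith

/-- The layered induction: with high probability few bins reach the `J`-th level. -/
lemma pairExp_layers_le (J : ℕ) (x y : ℕ → V) :
    pairExp G ((Fintype.card V / τ + 1) * τ) 0 x y (fun x' y' =>
      ind (layerFraction X J * Fintype.card V <
          (heavyBins tie x' y' (80 + J) (Fintype.card V)).card)) ≤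
      J * (X * Real.exp (-(7 * X))) := by
  induction J with
  | zero =>
    refine le_trans (pairExp_mono (g := fun _ _ => 0) fun x' y' => (ind_of_false ?_).le) ?_
    · rw [not_lt]
      have h1 := card_heavyBins_mul_le (tie := tie) (x := x') (y := y') 80 (Fintype.card V)
      have h2 : ((heavyBins tie x' y' 80 (Fintype.card V)).card : ℝ) * 80 ≤ Fintype.card V := by
        exact_mod_cast h1
      -- The induction starts deterministically: `n` balls fill at most `n / 80` bins to level `80`.
      have h3 : (1 : ℝ) / 80 ≤ layerFraction X 0 := by
        refine le_trans (le_of_eq ?_) (le_max_left _ _)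
        norm_num
      calc _ ≤ 1 / 80 * (Fintype.card V : ℝ) := by linarith
        _ ≤ _ := by gcongr
    · rw [pairExp_const hG]; simp
  | succ J ih =>
    have hstep := pairExp_layer_le hG hM hR hη hτ hX hτX hXn hηX tie (80 + J) J x y
    refine le_trans (pairExp_mono fun x' y' => le_trans (ind_mono fun h => ?_) (ind_or_le
      (layerFraction X J * Fintype.card V < (heavyBins tie x' y' (80 + J) (Fintype.card V)).card)
      (((heavyBins tie x' y' (80 + J) (Fintype.card V)).card : ℝ) ≤
          layerFraction X J * Fintype.card V ∧ layerFraction X (J + 1) * Fintype.card V <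
        (heavyBins tie x' y' (80 + J + 1) (Fintype.card V)).card))) ?_
    · exact (lt_or_ge _ _).imp id fun h' => ⟨h', h⟩
    rw [pairExp_add]
    push_cast
    linarith

/-- With `μ = 3 / n` and `b = n / X`, mixing contributes `9 / X` per double level and returns
contribute at most `2 / X`. -/
lemma pairExp_tail_le {i₁ : ℕ} (L : ℕ) (x y : ℕ → V) : ∀ t < Fintype.card V,
    pairExp G ((Fintype.card V / τ + 1) * τ) 0 x y (fun x' y' =>
      ind (BothHeavy tie x' y' (i₁ + 2 * L) t ∧
        ((heavyBins tie x' y' i₁ t).card : ℝ) ≤ X⁻¹ * Fintype.card V)) ≤ (11 / X) ^ L := by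
  set n := Fintype.card V with hn
  have hX0 : 0 < X := by linarith
  have hn0 : (0 : ℝ) < n := lt_of_lt_of_le (by positivity) hXn
  have hnM : n ≤ (n / τ + 1) * τ := by
    rw [mul_comm]; exact (Nat.lt_mul_div_succ n hτ).le
  induction L with
  | zero =>
    intro t _
    rw [pow_zero, ← pairExp_const hG (m := (n / τ + 1) * τ) (t := 0) (x := x) (y := y) 1]
    exact pairExp_mono fun x' y' => ind_le_one _
  | succ L ih =>
    intro t ht
    refine (pairExp_bothHeavy_add_two_le hG hM hR tie (by positivity) hη hτ hnM
      (i := i₁ + 2 * L) (by omega) (by positivity) (by positivity) x y ih t ht).trans ?_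
    rw [pow_succ (11 / X), mul_comm _ (11 / X)]
    refine mul_le_mul_of_nonneg_right ?_ (by positivity)
    have h1 : (3 / (n : ℝ)) ^ 2 * (X⁻¹ * n) * n = 9 / X := by
      field_simp; norm_num
    have h2 : 2 * (τ : ℝ) ^ 2 * η ≤ 2 / X := by
      calc 2 * (τ : ℝ) ^ 2 * η ≤ 2 * X ^ 2 * (X ^ 4)⁻¹ := by gcongr
        _ = (2 / X) * X⁻¹ := by field_simp
        _ ≤ 2 / X := mul_le_of_le_one_right (by positivity) (inv_le_one_of_one_le₀ (by linarith))
    rw [h1]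
    calc _ ≤ 9 / X + 2 / X := by gcongr
      _ = 11 / X := by ring

/-- A bound for the probability of a large maximum load. -/
lemma pairExp_maxLoad_le {J : ℕ} (hJ : (1 / 2 : ℝ) ^ 2 ^ J / 40 ≤ X⁻¹) (L : ℕ) (x y : ℕ → V) :
    pairExp G ((Fintype.card V / τ + 1) * τ) 0 x y (fun x' y' =>
      ind (80 + J + 2 * L < maxLoad tie x' y' (Fintype.card V))) ≤
      J * (X * Real.exp (-(7 * X))) + Fintype.card V * (11 / X) ^ L := by
  set n := Fintype.card V with hn
  have hfrac : layerFraction X J = X⁻¹ := max_eq_right hJ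
  have hlay := pairExp_layers_le hG hM hR hη hτ hX hτX hXn hηX tie J x y
  have htail := pairExp_tail_le hG hM hR hη hτ hX hτX hXn hηX tie (i₁ := 80 + J) L x y
  rw [hfrac] at hlay
  calc _ ≤ pairExp G ((n / τ + 1) * τ) 0 x y (fun x' y' =>
        ind (X⁻¹ * n < (heavyBins tie x' y' (80 + J) n).card) +
        ∑ t ∈ Finset.range n, ind (BothHeavy tie x' y' (80 + J + 2 * L) t ∧
          ((heavyBins tie x' y' (80 + J) t).card : ℝ) ≤ X⁻¹ * n)) := by
        refine pairExp_mono fun x' y' => ?_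
        refine le_trans (ind_mono (q := (X⁻¹ * n < (heavyBins tie x' y' (80 + J) n).card) ∨
          ∃ t ∈ Finset.range n, (BothHeavy tie x' y' (80 + J + 2 * L) t ∧
          ((heavyBins tie x' y' (80 + J) t).card : ℝ) ≤ X⁻¹ * n)) fun h => ?_)
          ((ind_or_le _ _).trans (add_le_add le_rfl (ind_exists_le_sum _ _)))
        refine (lt_or_ge (X⁻¹ * (n : ℝ)) ((heavyBins tie x' y' (80 + J) n).card : ℝ)).imp id
          fun h' => ?_
        obtain ⟨t, ht, hB⟩ := exists_bothHeavy_of_lt_maxLoad h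
        refine ⟨t, ht, hB, le_trans ?_ h'⟩
        exact_mod_cast Finset.card_le_card (heavyBins_mono le_rfl (Finset.mem_range.1 ht).le)
    _ ≤ J * (X * Real.exp (-(7 * X))) + (Finset.range n).card • (11 / X) ^ L := by
        rw [pairExp_add, pairExp_sum]
        exact add_le_add hlay (Finset.sum_le_card_nsmul _ _ _ fun t ht =>
          htail t (Finset.mem_range.1 ht))
    _ = _ := by rw [Finset.card_range, nsmul_eq_mul]

end Asymptotics

/-! ### Logarithmic mixing time, choice of parameters and conclusion. -/

/-- Non-backtracking walks on graphs with a spectral gap mix in logarithmic time. -/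
lemma exists_mixing_time {k : ℕ} (hk : 3 ≤ k) {lam : ℝ} (hlam : lam < k) :
    ∃ K : ℝ, 0 < K ∧ ∃ N : ℕ, ∀ n ≥ N, ∀ (G : SimpleGraph (Fin n)) [DecidableRel G.Adj],
      G.IsRegularOfDegree k → secondEigenvalue G ≤ lam →
        MixesWithin G (⌈K * Real.log n⌉₊ + 1) (3 / n) := by
  have hk3 : (3 : ℝ) ≤ k := by exact_mod_cast hk
  set q : ℝ := (k : ℝ) - 1 with hq
  have hq2 : 2 ≤ q := by rw [hq]; linarith
  have hq0 : 0 < q := by linarith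
  -- At `r = q` the bound `r + q / r` equals `k`, which exceeds `lam`; by continuity some `r < q`
  -- still works, so the error decays like `(r / q) ^ m`.
  obtain ⟨r, ⟨hr1, hr2, hr3⟩, hrq⟩ : ∃ r : ℝ, (1 ≤ r ∧ q ≤ r ^ 2 ∧ lam ≤ r + q / r) ∧ r < q := by
    have hc : ContinuousAt (fun r : ℝ => r + q / r) q :=
      continuousAt_id.add (continuousAt_const.div continuousAt_id hq0.ne')
    have hc2 : ContinuousAt (fun r : ℝ => r ^ 2) q := continuousAt_id.pow 2
    have e1 : ∀ᶠ r : ℝ in nhds q, lam < r + q / r :=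
      hc.eventually (lt_mem_nhds (by
        show lam < q + q / q
        rw [div_self hq0.ne', hq]; linarith))
    have e2 : ∀ᶠ r : ℝ in nhds q, q < r ^ 2 := hc2.eventually (lt_mem_nhds (by nlinarith))
    have e3 : ∀ᶠ r : ℝ in nhds q, 1 < r := lt_mem_nhds (by linarith)
    have e4 : ∀ᶠ r : ℝ in nhdsWithin q (Set.Iio q), (1 ≤ r ∧ q ≤ r ^ 2 ∧ lam ≤ r + q / r) ∧ r < q := by
      filter_upwards [nhdsWithin_le_nhds e1, nhdsWithin_le_nhds e2, nhdsWithin_le_nhds e3,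
        self_mem_nhdsWithin] with r h1 h2 h3 h4
      exact ⟨⟨h3.le, h2.le, h1.le⟩, h4⟩
    exact e4.exists
  have hr0 : 0 < r := by linarith
  -- The decay is split as `σ ^ m * σ ^ m`: one factor absorbs the polynomial term, the other is at
  -- most `1 / n` by the choice of `K`.
  set σ : ℝ := Real.sqrt (r / q) with hσ
  have hσ0 : 0 < σ := Real.sqrt_pos.2 (div_pos hr0 hq0)
  have hσ1 : σ < 1 := by
    rw [hσ, Real.sqrt_lt' one_pos, one_pow, div_lt_one hq0]; exact hrq
  have hσ2 : σ ^ 2 = r / q := Real.sq_sqrt (div_pos hr0 hq0).le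
  have hlogσ : Real.log σ < 0 := Real.log_neg hσ0 hσ1
  have ht : Tendsto (fun m : ℕ => (6 * r ^ 2 + k) / q * ((m : ℝ) * σ ^ m + σ ^ m)) atTop
      (nhds ((6 * r ^ 2 + k) / q * (0 + 0))) :=
    ((tendsto_self_mul_const_pow_of_lt_one hσ0.le hσ1).add
      (tendsto_pow_atTop_nhds_zero_of_lt_one hσ0.le hσ1)).const_mul _
  rw [add_zero, mul_zero] at ht
  obtain ⟨m₀, hm₀⟩ := eventually_atTop.1 (ht.eventually (gt_mem_nhds zero_lt_one))
  set K : ℝ := (-Real.log σ)⁻¹ with hK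
  have hK0 : 0 < K := inv_pos.2 (by linarith)
  have hlim : Tendsto (fun n : ℕ => ⌈K * Real.log n⌉₊) atTop atTop :=
    tendsto_nat_ceil_atTop.comp
      ((Real.tendsto_log_atTop.comp tendsto_natCast_atTop_atTop).const_mul_atTop hK0)
  obtain ⟨N, hN⟩ := eventually_atTop.1 (hlim.eventually (eventually_ge_atTop m₀))
  refine ⟨K, hK0, max N 2, fun n hn G _ hreg hsec => ?_⟩
  have hn2 : 2 ≤ n := (le_max_right _ _).trans hn
  have hnpos : (0 : ℝ) < n := by exact_mod_cast (by omega : 0 < n)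
  set m := ⌈K * Real.log n⌉₊ with hm
  have hmm : m₀ ≤ m := hN n ((le_max_left _ _).trans hn)
  have hkq : k / q ≤ 3 / 2 := by
    rw [div_le_iff₀ hq0, hq]; linarith
  refine mixesWithin_of_nbCount_le hk hreg ?_ fun x v => ?_
  · rw [Fintype.card_fin]
    gcongr
    linarith
  · have h1 := nbCount_le hk hreg (by rw [Fintype.card_fin]; omega) hr1 hr2
      (lt_of_le_of_lt hsec hlam) (hsec.trans hr3) m x v
    rw [Fintype.card_fin] at h1
    have h2 := hm₀ m hmm
    have h3 : σ ^ m ≤ 1 / n := by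
      have hle : Real.log n ≤ m * (-Real.log σ) := by
        have := Nat.le_ceil (K * Real.log n)
        rw [← hm, hK, inv_mul_eq_div, div_le_iff₀ (by linarith)] at this
        exact this
      rw [← Real.log_le_log_iff (by positivity) (by positivity), Real.log_pow, one_div,
        Real.log_inv]
      linarith
    calc ((q) ^ (m + 1))⁻¹ * nbCount G (m + 1) x v
        ≤ (q ^ (m + 1))⁻¹ * (k * q ^ m / n + (6 * r ^ 2 + k) * (m + 1) * r ^ m) :=
          mul_le_mul_of_nonneg_left h1 (by positivity)
      _ = k / q / n + (6 * r ^ 2 + k) / q * (m + 1) * (r / q) ^ m := by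
          rw [div_pow, pow_succ]; field_simp
      _ = k / q / n + ((6 * r ^ 2 + k) / q * (m * σ ^ m + σ ^ m)) * σ ^ m := by
          rw [← hσ2]; ring
      _ ≤ (3 / 2) / n + 1 * (1 / n) := by
          refine add_le_add (by gcongr) (mul_le_mul h2.le h3 (by positivity) zero_le_one)
      _ = (5 / 2) / n := by ring
      _ ≤ 3 / n := by gcongr; norm_num

lemma maxLoad_pairDependsBelow {V : Type*} [Fintype V] [DecidableEq V] (tie : TieRule V) (t : ℕ) :
    PairDependsBelow t fun x y : ℕ → V => maxLoad tie x y t :=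
  fun x x' y y' hx hy => by simp only [maxLoad, load_congr hx hy]

/-- The asymptotic inequalities that make the error terms small. -/
lemma eventually_error_small {δ K ε : ℝ} (hδ : 0 < δ) (hε : 0 < ε) (B : ℝ) :
    ∀ᶠ n : ℕ in atTop, 40 ≤ (n : ℝ) ^ δ ∧ K * Real.log n + 2 ≤ (n : ℝ) ^ δ ∧
      2 * Real.log n + 1 ≤ (n : ℝ) ^ δ ∧ 1 ≤ Real.log n ∧
      ((n : ℝ) ^ δ) ^ 2 * Real.exp (-(7 * (n : ℝ) ^ δ)) + B / (n : ℝ) ^ δ ≤ ε := by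
  have hX : Tendsto (fun n : ℕ => (n : ℝ) ^ δ) atTop atTop :=
    (tendsto_rpow_atTop hδ).comp tendsto_natCast_atTop_atTop
  have hlog : Tendsto (fun n : ℕ => Real.log n) atTop atTop :=
    Real.tendsto_log_atTop.comp tendsto_natCast_atTop_atTop
  have hlo : ∀ c > 0, ∀ᶠ n : ℕ in atTop, Real.log n ≤ c * (n : ℝ) ^ δ := by
    intro c hc
    have := ((isLittleO_log_rpow_atTop hδ).comp_tendsto tendsto_natCast_atTop_atTop).bound hc
    filter_upwards [this, hlog.eventually_ge_atTop 0] with n hn h0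
    simpa [abs_of_nonneg h0, abs_of_nonneg (Real.rpow_nonneg (Nat.cast_nonneg n) δ)] using hn
  have he1 : Tendsto (fun x : ℝ => x ^ 2 * Real.exp (-(7 * x)) + B / x) atTop (nhds (0 + 0)) := by
    refine Tendsto.add ?_ (tendsto_const_nhds.div_atTop tendsto_id)
    have := Real.tendsto_pow_mul_exp_neg_atTop_nhds_zero 2
    refine squeeze_zero' ?_ ?_ this
    · exact Eventually.of_forall fun x => by positivity
    · filter_upwards [eventually_ge_atTop 0] with x hx
      gcongr
      linarith
  rw [add_zero] at he1
  have he := (he1.comp hX).eventually (gt_mem_nhds hε)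
  filter_upwards [hX.eventually_ge_atTop 40, hlo (1 / (2 * (|K| + 1))) (by positivity),
    hlo (1 / 4) (by norm_num), hlog.eventually_ge_atTop 1, he] with n h1 h2 h3 h4 h5
  refine ⟨h1, ?_, by linarith, h4, h5.le⟩
  have hK : K * Real.log n ≤ (|K| + 1) * Real.log n := by
    have := le_abs_self K
    gcongr
    linarith
  have : (|K| + 1) * Real.log n ≤ (n : ℝ) ^ δ / 2 := by
    calc (|K| + 1) * Real.log n ≤ (|K| + 1) * (1 / (2 * (|K| + 1)) * (n : ℝ) ^ δ) := by gcongr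
      _ = (n : ℝ) ^ δ / 2 := by field_simp
  linarith

/-- Passing from a real `limsup` to an eventual bound requires boundedness above, which regularity
provides. -/
lemma eventually_secondEigenvalue_le {k : ℕ} {I : Set ℕ} {G : ∀ n : ℕ, SimpleGraph (Fin n)}
    [∀ n, DecidableRel (G n).Adj] (hreg : ∀ n ∈ I, (G n).IsRegularOfDegree k) {lam : ℝ}
    (h : limsupSecondEigenvalue I G < lam) :
    ∀ᶠ n in atTop, n ∈ I → secondEigenvalue (G n) ≤ lam := by
  have hb : IsBoundedUnder (· ≤ ·) (atTop ⊓ 𝓟 I) fun n => secondEigenvalue (G n) :=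
    isBoundedUnder_of_eventually_le (a := (k : ℝ))
      (eventually_inf_principal.2 (Eventually.of_forall fun n hn => secondEigenvalue_le (hreg n hn)))
  have := eventually_inf_principal.1 (eventually_lt_of_limsup_lt h hb)
  filter_upwards [this] with n hn hI
  exact (hn hI).le

theorem mainTheorem3 (k : ℕ) (hk : 3 ≤ k) (α : ℝ) (hα : 0 < α) (lam : ℝ) :
    ∃ C : ℝ, ∀ (I : Set ℕ) (G : ∀ n : ℕ, SimpleGraph (Fin n)) [∀ n, DecidableRel (G n).Adj],
      IsExpanderSequence k I G →
      limsupSecondEigenvalue I G = lam →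
      (∀ n ∈ I, ((2 * ⌈α * Real.logb ((k : ℝ) - 1) (n : ℝ)⌉₊ + 1 : ℕ) : ℕ∞) < (G n).egirth) →
      ∀ ε : ℝ, 0 < ε → ∃ N : ℕ, ∀ n ∈ I, N ≤ n →
        ∀ (tie : TieRule (Fin n)) {Ω : Type*} [MeasurableSpace Ω] (P : Measure Ω)
          [IsProbabilityMeasure P] (W₁ W₂ : ℕ → Ω → Fin n),
          IsNonBacktrackingWalk (G n) P W₁ →
          IsNonBacktrackingWalk (G n) P W₂ →
          IndepFun (fun ω t => W₁ t ω) (fun ω t => W₂ t ω) P →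
          1 - ε ≤ P.real {ω | (maxLoad tie (fun t => W₁ t ω) (fun t => W₂ t ω) n : ℝ) ≤
            Real.logb 2 (Real.log (n : ℝ)) + C} := by
  have hk3 : (3 : ℝ) ≤ k := by exact_mod_cast hk
  -- The exponent makes `X ^ 4` at most both `n` and `n ^ α`, the latter bounding the inverse return
  -- probability from below.
  set δ : ℝ := min α 1 / 4 with hδ
  have hδ0 : 0 < δ := by positivity
  have hδα : δ * 4 ≤ α := by rw [hδ]; linarith [min_le_left α 1]
  have hδ1 : δ * 4 ≤ 1 := by rw [hδ]; linarith [min_le_right α 1]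
  -- Already `X ^ ⌈1 / δ⌉₊ ≥ n`; the extra double level leaves a factor `1 / X` tending to `0`.
  set L : ℕ := ⌈1 / δ⌉₊ + 1 with hL
  -- Here `80` is the starting level, `1` the rounding in `J`, and `2 * L` the tail levels. The
  -- value depends only on `α`; `k` and `lam` affect only how large `n` must be.
  refine ⟨80 + 1 + 2 * L, fun I G _ hexp hlim hgirth ε hε => ?_⟩
  have hlamk : lam < k := hlim ▸ hexp.limsup_lt
  obtain ⟨K, -, N₁, hN₁⟩ := exists_mixing_time hk (lam := (lam + k) / 2) (by linarith)
  obtain ⟨N₂, hN₂⟩ := eventually_atTop.1 ((eventually_secondEigenvalue_le hexp.regular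
    (lam := (lam + k) / 2) (by rw [hlim]; linarith)).and
    (eventually_error_small (K := K) hδ0 hε (11 ^ L)))
  refine ⟨max N₁ (max N₂ 1), fun n hn hNn tie Ω _ P _ W₁ W₂ hW₁ hW₂ hind => ?_⟩
  have hn1 : 1 ≤ n := (le_max_right _ _).trans ((le_max_right _ _).trans hNn)
  obtain ⟨hsec, hX, hτX, hJX, hlog, herr⟩ :=
    hN₂ n ((le_max_left _ _).trans ((le_max_right _ _).trans hNn))
  have hreg := hexp.regular n hn
  have hmix := hN₁ n ((le_max_left _ _).trans hNn) (G n) hreg (hsec hn)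
  have hn1r : (1 : ℝ) ≤ n := by exact_mod_cast hn1
  have hn0 : (0 : ℝ) < n := by linarith
  have : Nonempty (Fin n) := ⟨⟨0, hn1⟩⟩
  set X : ℝ := (n : ℝ) ^ δ with hXdef
  have hX0 : 0 < X := by linarith
  set τ : ℕ := ⌈K * Real.log n⌉₊ + 1 with hτ
  set ρ : ℕ := ⌈α * Real.logb ((k : ℝ) - 1) n⌉₊ with hρ
  set J : ℕ := ⌈Real.logb 2 (Real.log n)⌉₊ with hJ
  have hret := returnsAtMost_of_girth hk hreg (hgirth n hn)
  have hX4 : X ^ 4 = (n : ℝ) ^ (δ * 4) := by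
    rw [hXdef, ← Real.rpow_natCast, ← Real.rpow_mul hn0.le]; norm_num
  have hXn : X ^ 4 ≤ n := by
    rw [hX4]
    simpa using Real.rpow_le_rpow_of_exponent_le hn1r hδ1
  have hXρ : X ^ 4 ≤ ((k : ℝ) - 1) ^ ρ := by
    have hq1 : (1 : ℝ) < (k : ℝ) - 1 := by linarith
    calc X ^ 4 ≤ (n : ℝ) ^ α := by
          rw [hX4]; exact Real.rpow_le_rpow_of_exponent_le hn1r hδα
      _ = ((k : ℝ) - 1) ^ (α * Real.logb ((k : ℝ) - 1) n) := by
          rw [mul_comm, Real.rpow_mul (by linarith), Real.rpow_logb (by linarith) hq1.ne' hn0]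
      _ ≤ ((k : ℝ) - 1) ^ (ρ : ℝ) :=
          Real.rpow_le_rpow_of_exponent_le hq1.le (Nat.le_ceil _)
      _ = _ := Real.rpow_natCast _ _
  have hlb : 0 ≤ Real.logb 2 (Real.log n) := Real.logb_nonneg (by norm_num) hlog
  have hJle : (J : ℝ) ≤ Real.logb 2 (Real.log n) + 1 := (Nat.ceil_lt_add_one hlb).le
  have hτle : (τ : ℝ) ≤ X := by
    by_cases hK : 0 ≤ K * Real.log n
    · have := Nat.ceil_lt_add_one hK
      rw [hτ]; push_cast; linarith
    · rw [hτ, Nat.ceil_eq_zero.2 (not_le.1 hK).le]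
      norm_num; linarith
  have hJleX : (J : ℝ) ≤ X := by
    refine le_trans hJle (le_trans ?_ hJX)
    have h1 : Real.logb 2 (Real.log n) ≤ 2 * Real.log n := by
      rw [Real.logb, div_le_iff₀ (Real.log_pos (by norm_num))]
      have := Real.log_le_sub_one_of_pos (by linarith : 0 < Real.log n)
      nlinarith [Real.log_two_gt_d9]
    linarith
  have hJpow : (1 / 2 : ℝ) ^ 2 ^ J / 40 ≤ X⁻¹ := by
    have h1 : Real.log n ≤ (2 ^ J : ℕ) := by
      calc Real.log n = 2 ^ Real.logb 2 (Real.log n) :=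
            (Real.rpow_logb (by norm_num) (by norm_num) (by linarith)).symm
        _ ≤ (2 : ℝ) ^ (J : ℝ) :=
            Real.rpow_le_rpow_of_exponent_le (by norm_num) (Nat.le_ceil _)
        _ = _ := by rw [Real.rpow_natCast]; push_cast; rfl
    -- Since `2 ^ J ≥ log n`, the left side is at most `n ^ (-log 2)`, and `δ ≤ 1 / 4 < log 2`.
    have h2 : (1 / 2 : ℝ) ^ 2 ^ J ≤ X⁻¹ := by
      rw [← Real.log_le_log_iff (by positivity) (by positivity), Real.log_pow, one_div,
        Real.log_inv, Real.log_inv, hXdef, Real.log_rpow hn0]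
      nlinarith [Real.log_two_gt_d9]
    have : (0 : ℝ) < (1 / 2 : ℝ) ^ 2 ^ J := by positivity
    linarith
  have hcard : ((Fintype.card (Fin n) : ℕ) : ℝ) = n := by rw [Fintype.card_fin]
  have hbound := pairExp_maxLoad_le (nextSet_nonempty hk hreg) (by rw [hcard]; exact hmix) hret
    (inv_nonneg.2 (pow_nonneg (by linarith) ρ)) (by omega : 1 ≤ τ) hX hτle (by rw [hcard]; exact hXn)
    (inv_anti₀ (by positivity) hXρ) tie hJpow L (fun _ => ⟨0, hn1⟩) (fun _ => ⟨0, hn1⟩)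
  rw [Fintype.card_fin] at hbound
  have hnX : (n : ℝ) * (11 / X) ^ L ≤ 11 ^ L / X := by
    have h1 : (n : ℝ) ≤ X ^ ⌈1 / δ⌉₊ := by
      calc (n : ℝ) = X ^ (1 / δ) := by
            rw [hXdef, ← Real.rpow_mul hn0.le, mul_one_div_cancel hδ0.ne', Real.rpow_one]
        _ ≤ X ^ ((⌈1 / δ⌉₊ : ℕ) : ℝ) :=
            Real.rpow_le_rpow_of_exponent_le (by linarith) (Nat.le_ceil _)
        _ = _ := Real.rpow_natCast _ _
    calc (n : ℝ) * (11 / X) ^ L ≤ X ^ ⌈1 / δ⌉₊ * (11 / X) ^ L := by gcongr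
      _ = 11 ^ L / X := by
        rw [div_pow, hL, pow_succ X]; field_simp
  have hfail : J * (X * Real.exp (-(7 * X))) + n * (11 / X) ^ L ≤ ε := by
    refine le_trans (add_le_add ?_ hnX) herr
    calc J * (X * Real.exp (-(7 * X))) ≤ X * (X * Real.exp (-(7 * X))) := by gcongr
      _ = _ := by ring
  set H := (n / τ + 1) * τ with hH
  have hnH : n ≤ H := by
    rw [hH, mul_comm]; exact (Nat.lt_mul_div_succ n (by omega)).le
  have hdep : PairDependsBelow H fun x y : ℕ → Fin n => maxLoad tie x y n ≤ 80 + J + 2 * L :=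
    ((maxLoad_pairDependsBelow tie n).mono hnH).comp (· ≤ 80 + J + 2 * L)
  have hprob := prob_eq_pairExp hk hreg hW₁ hW₂ hind hdep (fun _ => ⟨0, hn1⟩) (fun _ => ⟨0, hn1⟩)
  have hcompl : pairExp (G n) H 0 (fun _ => ⟨0, hn1⟩) (fun _ => ⟨0, hn1⟩)
      (fun x y => ind (maxLoad tie x y n ≤ 80 + J + 2 * L)) +
      pairExp (G n) H 0 (fun _ => ⟨0, hn1⟩) (fun _ => ⟨0, hn1⟩)
      (fun x y => ind (80 + J + 2 * L < maxLoad tie x y n)) = 1 := by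
    rw [← pairExp_add]
    refine (pairExp_congr fun x y => ?_).trans (pairExp_const (nextSet_nonempty hk hreg) 1)
    by_cases h : maxLoad tie x y n ≤ 80 + J + 2 * L
    · rw [ind_of_true h, ind_of_false (not_lt.2 h), add_zero]
    · rw [ind_of_false h, ind_of_true (not_le.1 h), zero_add]
  calc 1 - ε ≤ P.real {ω | maxLoad tie (fun t => W₁ t ω) (fun t => W₂ t ω) n ≤ 80 + J + 2 * L} := by
        rw [hprob]; linarith
    _ ≤ _ := by
        refine measureReal_mono fun ω hω => ?_
        have h1 : (maxLoad tie (fun t => W₁ t ω) (fun t => W₂ t ω) n : ℝ) ≤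
            ((80 + J + 2 * L : ℕ) : ℝ) := by exact_mod_cast hω
        push_cast at h1
        show (maxLoad tie (fun t => W₁ t ω) (fun t => W₂ t ω) n : ℝ) ≤ _
        linarith
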